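/- Let $G$ be a finite group, $k$ an algebraically closed field of characteristic zero, and $D(G)$ the Drinfel'd double of $G$ over $k$: the Hopf algebra with basis $e_g\# h$ ($g,h\in G$), product $(e_g\# g')(e_h\# h')=\delta_{g,\,g'hg'^{-1}}\,e_g\# g'h'$, coproduct $\Delta(e_g\# h)=\sum_{ab=g}(e_b\# h)\otimes(e_a\# h)$ and counit $\varepsilon(e_g\# h)=\delta_{g,1}$. Let $\mathrm{Aut}(D(G))$ be its group of Hopf algebra automorphisms. For $\psi\in\mathrm{Aut}(D(G))$ define the components $u(a)=(\mathrm{id}\otimes\varepsilon)\psi(a\#1)$, $p(a)=(\mathrm{ev}_1\otimes\mathrm{id})\psi(a\#1)$, $r(g)=(\mathrm{id}\otimes\varepsilon)\psi(\varepsilon\# g)$, $v(g)=(\mathrm{ev}_1\otimes\mathrm{id})\psi(\varepsilon\# g)$ for $a\in k^G$, $g\in G$, where $\varepsilon=\sum_g e_g\in k^G$ in $\varepsilon\# g$. Let $\Lambda(G)$ be the subgroup of those $\psi$ for which $u=\mathrm{id}$, $r(g)=\varepsilon$ for all $g$, and $v(g)=g$ for all $g$ (with $p$ arbitrary). Let $\widehat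 G=\mathrm{Hom}(G,k^\times)$, $\mathrm{BCh}(G)=\mathrm{Hom}(G,\widehat G)$ the group of bicharacters, $\mathrm{Aut}_c(G)=C_{\mathrm{Aut}(G)}(\mathrm{Inn}(G))$, and $\mathrm{SpAut}_c(G)=\{(w,v)\in\mathrm{Aut}(G)^2: w^{-1}v\in\mathrm{Aut}_c(G)\}$. Form $\mathrm{BCh}(G)\rtimes\mathrm{SpAut}_c(G)$, where $(w,v)$ acts by $((w,v)\cdot r)(h)(g)=r(v^{-1}h)(w^{-1}g)$. It embeds in $\mathrm{Aut}(D(G))$ by letting $r\in\mathrm{BCh}(G)$ act as $e_g\# h\mapsto r(h)(g)\,e_g\# h$ and $(w,v)\in\mathrm{SpAut}_c(G)$ as $e_g\# h\mapsto e_{w(g)}\# v(h)$. Call $G$ a stem group if $Z(G)\le G'$. Then: 1. $\Lambda(G)$ is normal in $\mathrm{Aut}(D(G))$ if and only if $G$ is a stem group. 2. $\mathrm{Aut}(D(G))$ is the semidirect product $\Lambda(G)\rtimes(\mathrm{BCh}(G)\rtimes\mathrm{SpAut}_c(G))$ of these subgroups if and only if $G$ is a stem group. Here the left-hand side means: for some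 action of $\mathrm{BCh}(G)\rtimes\mathrm{SpAut}_c(G)$ on $\Lambda(G)$ there is a group isomorphism $\Lambda(G)\rtimes(\mathrm{BCh}(G)\rtimes\mathrm{SpAut}_c(G))\to\mathrm{Aut}(D(G))$ that restricts on the two factors to the inclusion of $\Lambda(G)$ and to the embedding above. -/

import Mathlib

set_option linter.unusedSectionVars false

section HopfAut

/-- Automorphisms of the bialgebra `A` (for a Hopf algebra these are the Hopf algebra
automorphisms, since the antipode is preserved automatically) form a group under composition. -/
instance BialgEquiv.instGroupAut {R A : Type*} [CommSemiring R] [Semiring A] [Bialgebra R A] :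
    Group (A ≃ₐc[R] A) where
  mul f g := g.trans f
  one := BialgEquiv.refl R A
  inv f := f.symm
  mul_assoc _ _ _ := rfl
  one_mul _ := rfl
  mul_one _ := rfl
  inv_mul_cancel f := BialgEquiv.ext fun x => f.symm_apply_apply x

theorem BialgEquiv.aut_mul_apply {R A : Type*} [CommSemiring R] [Semiring A] [Bialgebra R A]
    (f g : A ≃ₐc[R] A) (x : A) : (f * g) x = f (g x) := rfl

theorem BialgEquiv.aut_one_apply {R A : Type*} [CommSemiring R] [Semiring A] [Bialgebra R A]
    (x : A) : (1 : A ≃ₐc[R] A) x = x := rfl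

theorem BialgEquiv.aut_apply_inv {R A : Type*} [CommSemiring R] [Semiring A] [Bialgebra R A]
    (f : A ≃ₐc[R] A) (x : A) : f (f⁻¹ x) = x := f.apply_symm_apply x

end HopfAut

/-- The Drinfeld double `D(G)` of a finite group over `k`. An element `x` is given by its
coefficients: `x (g, h)` is the coefficient of the basis vector `e_g # h`. -/
def DrinfeldDouble (k : Type*) (G : Type*) : Type _ := G × G → k

namespace DrinfeldDouble

open scoped TensorProduct

section Algebra

variable {k : Type*} [Field k] {G : Type*} [Group G] [Fintype G] [DecidableEq G]

instance instAddCommGroup : AddCommGroup (DrinfeldDouble k G) :=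
  inferInstanceAs (AddCommGroup (G × G → k))

instance instModule : Module k (DrinfeldDouble k G) := inferInstanceAs (Module k (G × G → k))

theorem ext' {x y : DrinfeldDouble k G} (h : ∀ g l, x (g, l) = y (g, l)) : x = y :=
  funext fun ⟨g, l⟩ => h g l

theorem add_apply (x y : DrinfeldDouble k G) (p : G × G) : (x + y) p = x p + y p := rfl

theorem zero_apply (p : G × G) : (0 : DrinfeldDouble k G) p = 0 := rfl

theorem smul_apply (c : k) (x : DrinfeldDouble k G) (p : G × G) : (c • x) p = c * x p := rfl

/-- The simple tensor `a # h`, for a function `a` on `G` and `h ∈ G`. -/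
def tmul (a : G → k) (h : G) : DrinfeldDouble k G := fun p => if p.2 = h then a p.1 else 0

/-- The basis vector `e_g # h`. -/
def basisVec (g h : G) : DrinfeldDouble k G := tmul (Pi.single g 1) h

theorem basisVec_eq (g h : G) :
    (basisVec g h : DrinfeldDouble k G) = (Pi.single (g, h) 1 : G × G → k) := by
  funext ⟨a, b⟩
  simp only [basisVec, tmul, Pi.single_apply, Prod.mk.injEq]
  by_cases h1 : a = g <;> by_cases h2 : b = h <;> simp [h1, h2]

theorem basisVec_apply (g h a b : G) :
    (basisVec g h : DrinfeldDouble k G) (a, b) = if a = g ∧ b = h then 1 else 0 := by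
  rw [basisVec_eq]; simp [Pi.single_apply]

theorem linearMap_ext {M : Type*} [AddCommMonoid M] [Module k M]
    {f f' : DrinfeldDouble k G →ₗ[k] M} (h : ∀ g l, f (basisVec g l) = f' (basisVec g l)) :
    f = f' := by
  refine LinearMap.pi_ext' (R := k) (φ := fun _ : G × G => k) (M := M) (f := f) (g := f')
    fun ⟨g, l⟩ => LinearMap.ext_ring ?_
  have := h g l
  rw [basisVec_eq] at this
  exact this

/-- `(e_g # g') (e_h # h') = δ_{g, g' h g'⁻¹} e_g # g' h'`, in coordinates. -/
instance instMul : Mul (DrinfeldDouble k G) :=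
  ⟨fun x y p => ∑ h : G, x (p.1, h) * y (h⁻¹ * p.1 * h, h⁻¹ * p.2)⟩

theorem mul_apply (x y : DrinfeldDouble k G) (g l : G) :
    (x * y) (g, l) = ∑ h : G, x (g, h) * y (h⁻¹ * g * h, h⁻¹ * l) := rfl

/-- The unit `ε # 1`. -/
instance instOne : One (DrinfeldDouble k G) := ⟨tmul 1 1⟩

theorem one_apply (g l : G) : (1 : DrinfeldDouble k G) (g, l) = if l = 1 then 1 else 0 := rfl

instance instRing : Ring (DrinfeldDouble k G) :=
  { instAddCommGroup, instMul, instOne with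
    left_distrib := fun x y z => ext' fun g l => by
      simp [mul_apply, add_apply, mul_add, Finset.sum_add_distrib]
    right_distrib := fun x y z => ext' fun g l => by
      simp [mul_apply, add_apply, add_mul, Finset.sum_add_distrib]
    zero_mul := fun x => ext' fun g l => by
      rw [mul_apply]
      exact Finset.sum_eq_zero fun h _ => zero_mul _
    mul_zero := fun x => ext' fun g l => by
      rw [mul_apply]
      exact Finset.sum_eq_zero fun h _ => mul_zero _
    one_mul := fun x => ext' fun g l => by
      simp [mul_apply, one_apply]
    mul_one := fun x => ext' fun g l => by
      simp [mul_apply, one_apply, inv_mul_eq_one]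
    mul_assoc := fun x y z => ext' fun g l => by
      simp only [mul_apply, Finset.sum_mul, Finset.mul_sum]
      rw [Finset.sum_comm]
      refine Finset.sum_congr rfl fun a _ => ?_
      refine Fintype.sum_equiv (Equiv.mulLeft a⁻¹) _ _ fun b => ?_
      simp [mul_assoc] }

instance instAlgebra : Algebra k (DrinfeldDouble k G) :=
  Algebra.ofModule
    (fun c x y => ext' fun g l => by
      simp [mul_apply, smul_apply, Finset.mul_sum, mul_assoc])
    (fun c x y => ext' fun g l => by
      simp [mul_apply, smul_apply, Finset.mul_sum, mul_left_comm])

theorem basisVec_mul (g g' h h' : G) :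
    (basisVec g g' * basisVec h h' : DrinfeldDouble k G) =
      if g = g' * h * g'⁻¹ then basisVec g (g' * h') else 0 := by
  refine ext' fun a b => ?_
  rw [mul_apply]
  simp only [basisVec_apply]
  rw [Finset.sum_eq_single g' (by intro c _ hc; simp [hc]) (by simp)]
  have h1 : g'⁻¹ * a * g' = h ↔ a = g' * h * g'⁻¹ := by
    constructor
    · rintro rfl; group
    · rintro rfl; group
  have h2 : g'⁻¹ * b = h' ↔ b = g' * h' := inv_mul_eq_iff_eq_mul
  have h3 : (if g = g' * h * g'⁻¹ then (basisVec g (g' * h') : DrinfeldDouble k G) else 0) (a, b) =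
      if g = g' * h * g'⁻¹ then (if a = g ∧ b = g' * h' then 1 else 0) else 0 := by
    split_ifs <;> simp_all [basisVec_apply, zero_apply]
  rw [h3]
  simp only [h1, h2]
  by_cases ha : a = g
  · subst ha
    by_cases hg : a = g' * h * g'⁻¹
    · simp [← hg]
    · simp [hg]
  · simp [ha]

theorem one_eq : (1 : DrinfeldDouble k G) = ∑ g : G, basisVec g 1 := by
  refine ext' fun a b => ?_
  have : (∑ g : G, basisVec g 1 : DrinfeldDouble k G) (a, b) =
      ∑ g : G, (basisVec g 1 : DrinfeldDouble k G) (a, b) := Finset.sum_apply _ _ _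
  rw [this, one_apply]
  simp [basisVec_apply, ite_and]

/-- The coefficient of `e_{p.1} # p.2`, as a linear form. -/
def coeff (p : G × G) : DrinfeldDouble k G →ₗ[k] k where
  toFun x := x p
  map_add' _ _ := rfl
  map_smul' _ _ := rfl

theorem coeff_apply (p : G × G) (x : DrinfeldDouble k G) : coeff p x = x p := rfl

/-- The coalgebra structure of `(k^G)^cop ⊗ kG`: `Δ(e_g # h) = ∑_{ab = g} (e_b # h) ⊗ (e_a # h)`
and `ε(e_g # h) = δ_{g, 1}`. -/
noncomputable instance instCoalgebraStruct : CoalgebraStruct k (DrinfeldDouble k G) where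
  comul := ∑ a : G, ∑ b : G, ∑ h : G,
    LinearMap.toSpanSingleton k _ (basisVec b h ⊗ₜ[k] basisVec a h) ∘ₗ
      (coeff (a * b, h))
  counit := ∑ h : G, coeff (1, h)

theorem comul_apply (x : DrinfeldDouble k G) :
    CoalgebraStruct.comul (R := k) x =
      ∑ a : G, ∑ b : G, ∑ h : G, x (a * b, h) • (basisVec b h ⊗ₜ[k] basisVec a h) := by
  simp only [CoalgebraStruct.comul, LinearMap.sum_apply]
  rfl

theorem counit_apply (x : DrinfeldDouble k G) :
    CoalgebraStruct.counit (R := k) x = ∑ h : G, x (1, h) := by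
  simp only [CoalgebraStruct.counit, LinearMap.sum_apply]
  rfl

theorem comul_basisVec (g h : G) :
    CoalgebraStruct.comul (R := k) (basisVec g h : DrinfeldDouble k G) =
      ∑ a : G, basisVec (a⁻¹ * g) h ⊗ₜ[k] basisVec a h := by
  rw [comul_apply]
  refine Finset.sum_congr rfl fun a _ => ?_
  rw [Finset.sum_eq_single (a⁻¹ * g), Finset.sum_eq_single h]
  · simp [basisVec_apply]
  · intro b _ hb; simp [basisVec_apply, hb]
  · simp
  · intro b _ hb
    refine Finset.sum_eq_zero fun l _ => ?_
    have : ¬ (a * b = g) := fun h' => hb (by rw [← h']; group)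
    simp [basisVec_apply, this]
  · simp

theorem counit_basisVec (g h : G) :
    CoalgebraStruct.counit (R := k) (basisVec g h : DrinfeldDouble k G) =
      if g = 1 then 1 else 0 := by
  rw [counit_apply]
  simp [basisVec_apply, ite_and, eq_comm]

noncomputable instance instCoalgebra : Coalgebra k (DrinfeldDouble k G) where
  coassoc := by
    refine linearMap_ext fun g h => ?_
    simp only [LinearMap.comp_apply, comul_basisVec, map_sum, LinearMap.rTensor_tmul,
      LinearMap.lTensor_tmul, TensorProduct.sum_tmul, TensorProduct.tmul_sum,
      LinearEquiv.coe_coe, TensorProduct.assoc_tmul]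
    conv_rhs => rw [Finset.sum_comm]
    refine Finset.sum_congr rfl fun a _ => ?_
    refine Fintype.sum_equiv (Equiv.mulLeft a) _ _ fun b => ?_
    simp [mul_assoc]
  rTensor_counit_comp_comul := by
    refine linearMap_ext fun g h => ?_
    simp only [LinearMap.comp_apply, comul_basisVec, map_sum, LinearMap.rTensor_tmul,
      counit_basisVec, TensorProduct.mk_apply]
    rw [Finset.sum_eq_single g]
    · simp
    · intro b _ hb
      have : ¬ (b⁻¹ * g = 1) := fun h' => hb (inv_mul_eq_one.1 h')
      simp [this]
    · simp
  lTensor_counit_comp_comul := by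
    refine linearMap_ext fun g h => ?_
    simp only [LinearMap.comp_apply, comul_basisVec, map_sum, LinearMap.lTensor_tmul,
      counit_basisVec]
    rw [Finset.sum_eq_single 1]
    · simp
    · intro b _ hb; simp [hb]
    · simp

noncomputable instance instBialgebra : Bialgebra k (DrinfeldDouble k G) where
  counit_one := by
    change CoalgebraStruct.counit (R := k) (1 : DrinfeldDouble k G) = 1
    rw [counit_apply]; simp [one_apply]
  mul_compr₂_counit := by
    refine linearMap_ext fun g g' => linearMap_ext fun h h' => ?_
    simp only [LinearMap.compr₂_apply, LinearMap.compl₁₂_apply, LinearMap.mul_apply']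
    rw [basisVec_mul, counit_basisVec, counit_basisVec]
    by_cases hg : g = 1
    · subst hg
      have : (1 = g' * h * g'⁻¹) ↔ h = 1 := by
        rw [eq_comm]; exact conj_eq_one_iff
      simp only [this]
      split_ifs <;> simp [counit_basisVec]
    · split_ifs <;> simp [counit_basisVec, hg]
  comul_one := by
    change CoalgebraStruct.comul (R := k) (1 : DrinfeldDouble k G) = 1
    rw [Algebra.TensorProduct.one_def, one_eq, map_sum]
    simp only [comul_basisVec, TensorProduct.sum_tmul, TensorProduct.tmul_sum]
    rw [Finset.sum_comm]
    conv_rhs => rw [Finset.sum_comm]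
    conv_rhs => rw [Finset.sum_comm]
    refine Finset.sum_congr rfl fun a _ => ?_
    exact Fintype.sum_equiv (Equiv.mulLeft a⁻¹) _ _ fun b => rfl
  mul_compr₂_comul := by
    refine linearMap_ext fun g g' => linearMap_ext fun h h' => ?_
    simp only [LinearMap.compr₂_apply, LinearMap.compl₁₂_apply, LinearMap.mul_apply']
    rw [basisVec_mul, comul_basisVec, comul_basisVec]
    simp only [Finset.sum_mul_sum, Algebra.TensorProduct.tmul_mul_tmul, basisVec_mul]
    have key : ∀ a : G, (∑ b : G,
        (if a⁻¹ * g = g' * (b⁻¹ * h) * g'⁻¹ then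
          (basisVec (a⁻¹ * g) (g' * h') : DrinfeldDouble k G) else 0) ⊗ₜ[k]
        (if a = g' * b * g'⁻¹ then (basisVec a (g' * h') : DrinfeldDouble k G) else 0)) =
        if g = g' * h * g'⁻¹ then
          basisVec (a⁻¹ * g) (g' * h') ⊗ₜ[k] basisVec a (g' * h') else 0 := by
      intro a
      rw [Finset.sum_eq_single (g'⁻¹ * a * g')]
      · have h1 : a⁻¹ * g = g' * ((g'⁻¹ * a * g')⁻¹ * h) * g'⁻¹ ↔ g = g' * h * g'⁻¹ := by
          have : g' * ((g'⁻¹ * a * g')⁻¹ * h) * g'⁻¹ = a⁻¹ * (g' * h * g'⁻¹) := by group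
          rw [this, mul_right_inj]
        have h2 : a = g' * (g'⁻¹ * a * g') * g'⁻¹ := by group
        rw [if_pos h2]
        simp only [h1]
        split_ifs <;> simp
      · intro b _ hb
        have : ¬ (a = g' * b * g'⁻¹) := fun h' => hb (by rw [h']; group)
        simp [this]
      · simp
    simp only [key]
    split_ifs <;> simp [comul_basisVec]

/-- The antipode `S(e_g # h) = e_{h⁻¹ g⁻¹ h} # h⁻¹`, in coordinates. -/
def antipodeMap : DrinfeldDouble k G →ₗ[k] DrinfeldDouble k G where
  toFun x p := x (p.2⁻¹ * p.1⁻¹ * p.2, p.2⁻¹)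
  map_add' _ _ := rfl
  map_smul' _ _ := rfl

theorem antipodeMap_basisVec (g h : G) :
    antipodeMap (basisVec g h : DrinfeldDouble k G) = basisVec (h⁻¹ * g⁻¹ * h) h⁻¹ := by
  refine ext' fun a b => ?_
  change (basisVec g h : DrinfeldDouble k G) (b⁻¹ * a⁻¹ * b, b⁻¹) = _
  rw [basisVec_apply, basisVec_apply]
  refine if_congr ?_ rfl rfl
  constructor
  · rintro ⟨h1, h2⟩
    rw [← h1, ← h2]
    constructor <;> group
  · rintro ⟨h1, h2⟩
    rw [h1, h2]
    constructor <;> group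

noncomputable instance instHopfAlgebra : HopfAlgebra k (DrinfeldDouble k G) where
  antipode := antipodeMap
  mul_antipode_rTensor_comul := by
    refine linearMap_ext fun g h => ?_
    simp only [LinearMap.comp_apply, comul_basisVec, map_sum, LinearMap.rTensor_tmul,
      LinearMap.mul'_apply, antipodeMap_basisVec, basisVec_mul, counit_basisVec,
      Algebra.linearMap_apply, inv_mul_cancel, inv_inv]
    by_cases hg : g = 1
    · subst hg
      rw [if_pos rfl, map_one, one_eq]
      refine Fintype.sum_equiv ((MulAut.conj h⁻¹).toEquiv) _ _ fun a => ?_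
      simp [mul_assoc]
    · rw [if_neg hg, map_zero]
      refine Finset.sum_eq_zero fun a _ => if_neg fun h' => hg ?_
      simpa [mul_assoc] using h'
  mul_antipode_lTensor_comul := by
    refine linearMap_ext fun g h => ?_
    simp only [LinearMap.comp_apply, comul_basisVec, map_sum, LinearMap.lTensor_tmul,
      LinearMap.mul'_apply, antipodeMap_basisVec, basisVec_mul, counit_basisVec,
      Algebra.linearMap_apply, mul_inv_cancel]
    by_cases hg : g = 1
    · subst hg
      rw [if_pos rfl, map_one, one_eq]
      refine Fintype.sum_equiv (Equiv.inv G) _ _ fun a => ?_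
      simp [mul_assoc]
    · rw [if_neg hg, map_zero]
      refine Finset.sum_eq_zero fun a _ => if_neg fun h' => hg ?_
      simpa [mul_assoc] using h'

end Algebra

section Lambda

variable {k : Type*} [Field k] {G : Type*} [Group G] [Fintype G] [DecidableEq G]

/-- `id ⊗ ε_{kG} : (k^G)^cop ⊗ kG → k^G`. -/
def projDual (x : DrinfeldDouble k G) : G → k := fun g => ∑ h : G, x (g, h)

/-- `ev_1 ⊗ id : (k^G)^cop ⊗ kG → kG`. -/
noncomputable def projGroup (x : DrinfeldDouble k G) : MonoidAlgebra k G :=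
  ∑ h : G, MonoidAlgebra.single h (x (1, h))

/-- The component `u : k^G → k^G` of an automorphism `ψ` of `D(G)`,
`u(a) = (id ⊗ ε)(ψ(a # 1))`. -/
noncomputable def compU (ψ : DrinfeldDouble k G ≃ₐc[k] DrinfeldDouble k G) (a : G → k) : G → k :=
  projDual (ψ (tmul a 1))

/-- The component `p : k^G → kG` of `ψ`, `p(a) = (ev_1 ⊗ id)(ψ(a # 1))`. -/
noncomputable def compP (ψ : DrinfeldDouble k G ≃ₐc[k] DrinfeldDouble k G) (a : G → k) :
    MonoidAlgebra k G :=
  projGroup (ψ (tmul a 1))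

/-- The component `r : kG → k^G` of `ψ`, on group elements, `r(g) = (id ⊗ ε)(ψ(ε # g))`. -/
noncomputable def compR (ψ : DrinfeldDouble k G ≃ₐc[k] DrinfeldDouble k G) (g : G) : G → k :=
  projDual (ψ (tmul 1 g))

/-- The component `v : kG → kG` of `ψ`, on group elements, `v(g) = (ev_1 ⊗ id)(ψ(ε # g))`. -/
noncomputable def compV (ψ : DrinfeldDouble k G ≃ₐc[k] DrinfeldDouble k G) (g : G) :
    MonoidAlgebra k G :=
  projGroup (ψ (tmul 1 g))

theorem tmul_one_eq (h : G) :
    (tmul 1 h : DrinfeldDouble k G) = ∑ g : G, basisVec g h := by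
  refine ext' fun a b => ?_
  have : (∑ g : G, basisVec g h : DrinfeldDouble k G) (a, b) =
      ∑ g : G, (basisVec g h : DrinfeldDouble k G) (a, b) := Finset.sum_apply _ _ _
  rw [this]
  simp [basisVec_apply, ite_and, tmul]

theorem comul_tmul_one (h : G) :
    CoalgebraStruct.comul (R := k) (tmul 1 h : DrinfeldDouble k G) = tmul 1 h ⊗ₜ[k] tmul 1 h := by
  simp only [tmul_one_eq, map_sum, comul_basisVec, TensorProduct.sum_tmul, TensorProduct.tmul_sum]
  rw [Finset.sum_comm]
  conv_rhs => rw [Finset.sum_comm]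
  conv_rhs => rw [Finset.sum_comm]
  refine Finset.sum_congr rfl fun a _ => ?_
  exact Fintype.sum_equiv (Equiv.mulLeft a⁻¹) _ _ fun b => rfl

/-- The `(g, h)` coordinate is recovered from `Δ` through the two projections. -/
theorem coeff_eq_comul (g h : G) :
    (coeff (g, h) : DrinfeldDouble k G →ₗ[k] k) =
      (LinearMap.mul' k k ∘ₗ TensorProduct.map (∑ l : G, coeff (g, l)) (coeff (1, h))) ∘ₗ
        CoalgebraStruct.comul := by
  refine linearMap_ext fun a b => ?_
  simp only [LinearMap.comp_apply, comul_basisVec, map_sum, TensorProduct.map_tmul,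
    LinearMap.mul'_apply, LinearMap.sum_apply, coeff_apply, basisVec_apply]
  rw [Finset.sum_eq_single 1]
  · by_cases h1 : g = a <;> simp [h1]
  · intro c _ hc; simp [hc.symm]
  · simp

theorem projDual_mul_tmul_one (x : DrinfeldDouble k G) (h : G) :
    projDual (x * tmul 1 h) = projDual x := by
  funext g
  simp only [projDual, mul_apply, tmul]
  rw [Finset.sum_comm]
  refine Finset.sum_congr rfl fun l _ => ?_
  rw [← Finset.mul_sum]
  simp [inv_mul_eq_iff_eq_mul]

theorem basisVec_eq_mul (g h : G) :
    (basisVec g h : DrinfeldDouble k G) = tmul (Pi.single g 1) 1 * tmul 1 h := by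
  rw [tmul_one_eq, Finset.mul_sum]
  change _ = ∑ i, basisVec g 1 * basisVec i h
  simp [basisVec_mul]

theorem projGroup_eq_single_iff (x : DrinfeldDouble k G) (h : G) :
    projGroup x = MonoidAlgebra.single h 1 ↔ ∀ l, x (1, l) = if l = h then 1 else 0 := by
  have key : ∀ l, (projGroup x).coeff l = x (1, l) := by
    intro l
    simp [projGroup, Finsupp.single_apply]
  constructor
  · intro hx l
    rw [← key, hx]
    simp [Finsupp.single_apply, eq_comm]
  · intro hx
    ext l
    rw [key, hx]
    simp [Finsupp.single_apply, eq_comm]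

/-- `u = id`, `r` trivial and `v = id`, in a form that is visibly closed under composition. -/
theorem comp_trivial_iff (ψ : DrinfeldDouble k G ≃ₐc[k] DrinfeldDouble k G) :
    ((∀ a, compU ψ a = a) ∧ (∀ g, compR ψ g = 1) ∧
      ∀ g, compV ψ g = MonoidAlgebra.single g 1) ↔
    ((∀ x, projDual (ψ x) = projDual x) ∧ ∀ h, ψ (tmul 1 h) = tmul 1 h) := by
  constructor
  · rintro ⟨hu, hr, hv⟩
    have h2 : ∀ h, ψ (tmul 1 h) = tmul 1 h := by
      intro h
      refine ext' fun g l => ?_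
      have e1 : CoalgebraStruct.comul (R := k) (ψ (tmul 1 h)) =
          ψ (tmul 1 h) ⊗ₜ[k] ψ (tmul 1 h) := by
        rw [← CoalgHomClass.map_comp_comul_apply, comul_tmul_one, TensorProduct.map_tmul]
        rfl
      have e2 : ψ (tmul 1 h) (g, l) = projDual (ψ (tmul 1 h)) g * ψ (tmul 1 h) (1, l) := by
        rw [← coeff_apply (g, l) (ψ (tmul 1 h)), coeff_eq_comul, LinearMap.comp_apply, e1]
        simp [TensorProduct.map_tmul, LinearMap.sum_apply, coeff_apply, projDual]
      have e3 := congrFun (hr h) g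
      have e4 := (projGroup_eq_single_iff _ _).1 (hv h) l
      rw [e2, e4]
      change compR ψ h g * _ = _
      rw [e3]
      simp [tmul]
    refine ⟨fun x => ?_, h2⟩
    funext g
    have : (∑ l : G, coeff (g, l)) ∘ₗ (ψ : DrinfeldDouble k G →ₗ[k] DrinfeldDouble k G) =
        (∑ l : G, coeff (g, l) : DrinfeldDouble k G →ₗ[k] k) := by
      refine linearMap_ext fun a b => ?_
      have e1 : projDual (ψ (basisVec a b)) = projDual (basisVec a b) := by
        rw [basisVec_eq_mul, map_mul, h2, projDual_mul_tmul_one, projDual_mul_tmul_one]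
        refine (hu _).trans ?_
        funext c
        simp [projDual, tmul]
      have := congrFun e1 g
      simpa [projDual, LinearMap.sum_apply, coeff_apply] using this
    have := LinearMap.congr_fun this x
    simpa [projDual, LinearMap.sum_apply, coeff_apply] using this
  · rintro ⟨h1, h2⟩
    refine ⟨fun a => ?_, fun g => ?_, fun g => ?_⟩
    · rw [compU, h1]; funext c; simp [projDual, tmul]
    · rw [compR, h1]; funext c; simp [projDual, tmul]
    · rw [compV, h2, projGroup_eq_single_iff]; intro l; simp [tmul]

variable (k G) in
/-- `Λ(G)`: the automorphisms of `D(G)` of the form `(p, u, r, v) = (p, id, 1, id)`. -/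
def Lambda : Subgroup (DrinfeldDouble k G ≃ₐc[k] DrinfeldDouble k G) where
  carrier := {ψ | (∀ a, compU ψ a = a) ∧ (∀ g, compR ψ g = 1) ∧
    ∀ g, compV ψ g = MonoidAlgebra.single g 1}
  one_mem' := (comp_trivial_iff 1).2 ⟨fun _ => rfl, fun _ => rfl⟩
  mul_mem' := fun {a b} ha hb => by
    have ha' := (comp_trivial_iff a).1 ha
    have hb' := (comp_trivial_iff b).1 hb
    refine (comp_trivial_iff (a * b)).2 ⟨fun x => ?_, fun h => ?_⟩
    · rw [BialgEquiv.aut_mul_apply, ha'.1, hb'.1]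
    · rw [BialgEquiv.aut_mul_apply, hb'.2, ha'.2]
  inv_mem' := fun {a} ha => by
    have ha' := (comp_trivial_iff a).1 ha
    refine (comp_trivial_iff a⁻¹).2 ⟨fun x => ?_, fun h => ?_⟩
    · rw [← ha'.1 (a⁻¹ x), BialgEquiv.aut_apply_inv]
    · have h3 := congrArg (a⁻¹ : DrinfeldDouble k G ≃ₐc[k] DrinfeldDouble k G) (ha'.2 h)
      exact h3.symm.trans (a.symm_apply_apply _)

end Lambda

end DrinfeldDouble

section Groups

variable (G : Type*) [Group G]

/-- A stem group: `Z(G) ≤ G'`. -/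
def IsStemGroup : Prop := Subgroup.center G ≤ commutator G

/-- The central automorphisms `Aut_c(G) = C_{Aut(G)}(Inn(G))`. -/
def centralAut : Subgroup (MulAut G) :=
  Subgroup.centralizer ((MulAut.conj : G →* MulAut G).range : Set (MulAut G))

instance centralAut_normal : (centralAut G).Normal := by
  have : ((MulAut.conj : G →* MulAut G).range).Normal := ⟨by
    rintro _ ⟨g, rfl⟩ f
    exact ⟨f g, MulEquiv.ext fun x => by simp⟩⟩
  exact Subgroup.normal_centralizer

/-- The split central automorphisms
`SpAut_c(G) = {(w, v) ∈ Aut(G) × Aut(G) : w⁻¹ ∘ v ∈ Aut_c(G)}`. -/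
def splitCentralAut : Subgroup (MulAut G × MulAut G) where
  carrier := {q | q.1⁻¹ * q.2 ∈ centralAut G}
  one_mem' := by simp [one_mem]
  mul_mem' := fun {a b} ha hb => by
    simp only [Set.mem_ofPred_eq, ← QuotientGroup.eq] at ha hb ⊢
    simp only [Prod.fst_mul, Prod.snd_mul, QuotientGroup.mk_mul, ha, hb]
  inv_mem' := fun {a} ha => by
    simp only [Set.mem_ofPred_eq, ← QuotientGroup.eq] at ha ⊢
    simp only [Prod.fst_inv, Prod.snd_inv, QuotientGroup.mk_inv, ha]

variable (k : Type*) [Field k]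

/-- Bicharacters `G × G → kˣ`, as the group `Hom(G, Ĝ)` with `Ĝ = Hom(G, kˣ)`. -/
abbrev Bicharacter : Type _ := G →* G →* kˣ

/-- The left action of `SpAut_c(G)` on bicharacters: in matrix terms `r ↦ (w⁻¹)^* r v⁻¹`,
that is `((w, v) • r)(h)(g) = r(v⁻¹ h)(w⁻¹ g)`. -/
def bicharacterAction : splitCentralAut G →* MulAut (Bicharacter G k) where
  toFun q :=
    { toFun := fun r =>
        { toFun := fun h => (r (q.1.2⁻¹ h)).comp (q.1.1⁻¹ : MulAut G).toMonoidHom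
          map_one' := by ext g; simp
          map_mul' := fun a b => by ext g; simp }
      invFun := fun r =>
        { toFun := fun h => (r (q.1.2 h)).comp (q.1.1 : MulAut G).toMonoidHom
          map_one' := by ext g; simp
          map_mul' := fun a b => by ext g; simp }
      left_inv := fun r => by ext h g; simp
      right_inv := fun r => by ext h g; simp
      map_mul' := fun r s => by ext h g; simp }
  map_one' := by ext r h g; simp
  map_mul' := fun a b => by ext r h g; simp

/-- `BCh(G) ⋊ SpAut_c(G)`. -/
abbrev BChSplit : Type _ := Bicharacter G k ⋊[bicharacterAction G k] splitCentralAut G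

end Groups

namespace DrinfeldDouble

section Embedding

variable {k : Type*} [Field k] {G : Type*} [Group G] [Fintype G] [DecidableEq G]

/-- A linear automorphism that is multiplicative and comultiplicative on the basis is a
Hopf algebra automorphism. -/
noncomputable def autOfBasis (f f' : DrinfeldDouble k G →ₗ[k] DrinfeldDouble k G)
    (h1 : ∀ x, f' (f x) = x) (h2 : ∀ x, f (f' x) = x)
    (hmul : ∀ g g' h h', f (basisVec g g' * basisVec h h') =
      f (basisVec g g') * f (basisVec h h'))
    (hcounit : ∀ g h, CoalgebraStruct.counit (R := k) (f (basisVec g h)) =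
      CoalgebraStruct.counit (R := k) (basisVec g h : DrinfeldDouble k G))
    (hcomul : ∀ g h, CoalgebraStruct.comul (R := k) (f (basisVec g h)) =
      TensorProduct.map f f (CoalgebraStruct.comul (R := k) (basisVec g h))) :
    DrinfeldDouble k G ≃ₐc[k] DrinfeldDouble k G where
  toLinearMap := f
  counit_comp := linearMap_ext hcounit
  map_comp_comul := linearMap_ext fun g h => (hcomul g h).symm
  invFun := f'
  left_inv := h1
  right_inv := h2
  map_mul' := fun x y => by
    have : (LinearMap.mul k (DrinfeldDouble k G)).compr₂ f =
        (LinearMap.mul k (DrinfeldDouble k G)).compl₁₂ f f := by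
      refine linearMap_ext fun g g' => linearMap_ext fun h h' => ?_
      simpa using hmul g g' h h'
    simpa using LinearMap.congr_fun (LinearMap.congr_fun this x) y

theorem basisVec_ext {ψ φ : DrinfeldDouble k G ≃ₐc[k] DrinfeldDouble k G}
    (h : ∀ g l, ψ (basisVec g l) = φ (basisVec g l)) : ψ = φ := by
  refine BialgEquiv.ext fun x => ?_
  have : (ψ : DrinfeldDouble k G →ₗ[k] DrinfeldDouble k G) = φ := linearMap_ext h
  exact LinearMap.congr_fun this x

/-- The linear map `e_g # h ↦ r(h)(g) e_g # h`, in coordinates. -/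
def bicharacterMap (r : Bicharacter G k) : DrinfeldDouble k G →ₗ[k] DrinfeldDouble k G where
  toFun x p := (r p.2 p.1 : k) * x p
  map_add' _ _ := ext' fun _ _ => mul_add _ _ _
  map_smul' _ _ := ext' fun _ _ => mul_left_comm _ _ _

theorem bicharacterMap_basisVec (r : Bicharacter G k) (g h : G) :
    bicharacterMap r (basisVec g h) = (r h g : k) • basisVec g h := by
  refine ext' fun a b => ?_
  change (r b a : k) * (basisVec g h : DrinfeldDouble k G) (a, b) = _
  rw [smul_apply, basisVec_apply]
  by_cases h1 : a = g ∧ b = h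
  · rw [h1.1, h1.2]
  · simp [h1]

/-- The embedding of the bicharacters in `Aut(D(G))`, `e_g # h ↦ r(h)(g) e_g # h`. -/
noncomputable def bicharacterAut (r : Bicharacter G k) :
    DrinfeldDouble k G ≃ₐc[k] DrinfeldDouble k G :=
  autOfBasis (bicharacterMap r) (bicharacterMap r⁻¹)
    (fun x => ext' fun g h => by
      change ((r⁻¹ h g : kˣ) : k) * ((r h g : k) * x (g, h)) = _
      simp)
    (fun x => ext' fun g h => by
      change (r h g : k) * (((r⁻¹ h g : kˣ) : k) * x (g, h)) = _
      simp)
    (fun g g' h h' => by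
      simp only [basisVec_mul, bicharacterMap_basisVec, smul_mul_assoc, mul_smul_comm]
      split_ifs with hg
      · rw [bicharacterMap_basisVec, smul_smul]
        have hv : r h' g = r h' h := by rw [hg]; simp
        rw [map_mul, MonoidHom.mul_apply, Units.val_mul, hv, mul_comm]
      · simp)
    (fun g h => by
      rw [bicharacterMap_basisVec, map_smul, counit_basisVec]
      by_cases hg : g = 1 <;> simp [hg])
    (fun g h => by
      rw [bicharacterMap_basisVec, map_smul, comul_basisVec, map_sum, Finset.smul_sum]
      refine Finset.sum_congr rfl fun a _ => ?_
      rw [TensorProduct.map_tmul, bicharacterMap_basisVec, bicharacterMap_basisVec,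
        TensorProduct.smul_tmul_smul]
      rw [← Units.val_mul, ← map_mul]
      congr 2
      simp)

theorem bicharacterAut_basisVec (r : Bicharacter G k) (g h : G) :
    bicharacterAut r (basisVec g h) = (r h g : k) • basisVec g h :=
  bicharacterMap_basisVec r g h

/-- `BCh(G) → Aut(D(G))` as a group homomorphism. -/
noncomputable def bicharacterHom :
    Bicharacter G k →* (DrinfeldDouble k G ≃ₐc[k] DrinfeldDouble k G) where
  toFun := bicharacterAut
  map_one' := basisVec_ext fun g h => by
    rw [bicharacterAut_basisVec, BialgEquiv.aut_one_apply]; simp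
  map_mul' r s := basisVec_ext fun g h => by
    rw [BialgEquiv.aut_mul_apply, bicharacterAut_basisVec, bicharacterAut_basisVec, map_smul,
      bicharacterAut_basisVec, smul_smul]
    simp [mul_comm]

/-- The linear map `e_g # h ↦ e_{w(g)} # v(h)`, in coordinates. -/
def permMap (w v : MulAut G) : DrinfeldDouble k G →ₗ[k] DrinfeldDouble k G where
  toFun x p := x (w⁻¹ p.1, v⁻¹ p.2)
  map_add' _ _ := rfl
  map_smul' _ _ := rfl

theorem permMap_basisVec (w v : MulAut G) (g h : G) :
    permMap w v (basisVec g h : DrinfeldDouble k G) = basisVec (w g) (v h) := by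
  refine ext' fun a b => ?_
  change (basisVec g h : DrinfeldDouble k G) (w⁻¹ a, v⁻¹ b) = _
  rw [basisVec_apply, basisVec_apply]
  refine if_congr ?_ rfl rfl
  constructor
  · rintro ⟨h1, h2⟩
    rw [← h1, ← h2]; simp
  · rintro ⟨h1, h2⟩
    rw [h1, h2]; simp

theorem splitCentralAut_conj (q : splitCentralAut G) (a g : G) :
    q.1.2 a * q.1.1 g * (q.1.2 a)⁻¹ = q.1.1 (a * g * a⁻¹) := by
  have hq : q.1.1⁻¹ * q.1.2 ∈ centralAut G := q.2
  obtain ⟨y, rfl⟩ := (q.1.1⁻¹ * q.1.2).surjective g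
  have h1 := Subgroup.mem_centralizer_iff.1 hq (MulAut.conj a) ⟨a, rfl⟩
  have h2 := congrArg q.1.1 (DFunLike.congr_fun h1 y)
  simp only [MulAut.mul_apply, MulAut.conj_apply, map_mul, map_inv, MulAut.apply_inv_self]
    at h2 ⊢
  exact h2.symm

/-- The embedding of `SpAut_c(G)` in `Aut(D(G))`, `e_g # h ↦ e_{w(g)} # v(h)`. -/
noncomputable def splitCentralAutAut (q : splitCentralAut G) :
    DrinfeldDouble k G ≃ₐc[k] DrinfeldDouble k G :=
  autOfBasis (permMap q.1.1 q.1.2) (permMap q.1.1⁻¹ q.1.2⁻¹)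
    (fun x => ext' fun g h => by
      change x (q.1.1⁻¹ (q.1.1⁻¹⁻¹ g), q.1.2⁻¹ (q.1.2⁻¹⁻¹ h)) = _
      simp)
    (fun x => ext' fun g h => by
      change x (q.1.1⁻¹⁻¹ (q.1.1⁻¹ g), q.1.2⁻¹⁻¹ (q.1.2⁻¹ h)) = _
      simp)
    (fun g g' h h' => by
      simp only [basisVec_mul, permMap_basisVec, splitCentralAut_conj, EmbeddingLike.apply_eq_iff_eq]
      split_ifs with hg
      · rw [permMap_basisVec, map_mul]
      · simp)
    (fun g h => by
      rw [permMap_basisVec, counit_basisVec, counit_basisVec]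
      simp)
    (fun g h => by
      rw [permMap_basisVec, comul_basisVec, comul_basisVec, map_sum]
      refine (Fintype.sum_equiv q.1.1.toEquiv _ _ fun a => ?_).symm
      simp [permMap_basisVec])

theorem splitCentralAutAut_basisVec (q : splitCentralAut G) (g h : G) :
    splitCentralAutAut q (basisVec g h : DrinfeldDouble k G) = basisVec (q.1.1 g) (q.1.2 h) :=
  permMap_basisVec q.1.1 q.1.2 g h

/-- `SpAut_c(G) → Aut(D(G))` as a group homomorphism. -/
noncomputable def splitCentralAutHom :
    splitCentralAut G →* (DrinfeldDouble k G ≃ₐc[k] DrinfeldDouble k G) where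
  toFun := splitCentralAutAut
  map_one' := basisVec_ext fun g h => by
    rw [splitCentralAutAut_basisVec, BialgEquiv.aut_one_apply]; simp
  map_mul' r s := basisVec_ext fun g h => by
    rw [BialgEquiv.aut_mul_apply, splitCentralAutAut_basisVec, splitCentralAutAut_basisVec,
      splitCentralAutAut_basisVec]
    simp

/-- The embedding of `BCh(G) ⋊ SpAut_c(G)` in `Aut(D(G))`. -/
noncomputable def bchSplitHom :
    BChSplit G k →* (DrinfeldDouble k G ≃ₐc[k] DrinfeldDouble k G) :=
  SemidirectProduct.lift bicharacterHom splitCentralAutHom fun q => by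
    refine MonoidHom.ext fun r => ?_
    change bicharacterAut (bicharacterAction G k q r) =
      splitCentralAutHom q * bicharacterAut r * (splitCentralAutHom q)⁻¹
    rw [← map_inv]
    refine basisVec_ext fun g h => ?_
    change _ = splitCentralAutAut q (bicharacterAut r (splitCentralAutAut q⁻¹ (basisVec g h)))
    rw [bicharacterAut_basisVec, splitCentralAutAut_basisVec, bicharacterAut_basisVec, map_smul,
      splitCentralAutAut_basisVec]
    simp [bicharacterAction]

/-- `((r, (w, v)))` acts by `e_g # h ↦ r(v(h))(w(g)) e_{w(g)} # v(h)`. -/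
theorem bchSplitHom_basisVec (x : BChSplit G k) (g h : G) :
    bchSplitHom x (basisVec g h : DrinfeldDouble k G) =
      (x.left (x.right.1.2 h) (x.right.1.1 g) : k) •
        basisVec (x.right.1.1 g) (x.right.1.2 h) := by
  change bicharacterAut x.left (splitCentralAutAut x.right (basisVec g h)) = _
  rw [splitCentralAutAut_basisVec, bicharacterAut_basisVec]

end Embedding

end DrinfeldDouble

/-! Write Z for the centre of G and view `ψ` as a matrix of components p : k^G → kG, u : k^G → k^G,
r : kG → k^G, v : kG → kG. Group-like elements of D(G) are χ # g, so r and v come from homomorphisms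
`charComp` : G → Ĝ and `groupComp` : G → G. The key fact is that p lives on the centre: p(e_g) = 0
unless g ∈ Z, and ψ(e_g # 1) involves only e_a # h with h ∈ Z (`mem_center_of_projGroup_ne_zero`,
`map_basisVec_one_apply_eq_zero`). Then u is an algebra map, dual to an endomorphism `dualComp` of
G.

If G is a stem group, every homomorphism from G to an abelian group kills Z. Hence in a composite
the cross terms r∘p and p∘r are trivial, the diagonal components compose separately and are
bijective, and elements of Λ(G) fix every χ # h. This gives normality (`Lambda_normal`). Moreover
the triple (u, r, v) of any ψ is realised by an element of BCh(G) ⋊ SpAut_c(G), which gives the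
decomposition.

Conversely, suppose a character χ of G is nontrivial on Z. An isomorphism of Z with its dual yields,
by Fourier inversion, an isomorphism k^Z → kZ and hence an element of Λ(G). Conjugating it by a
bicharacter r with r(h) = χ⁻¹ sends ε # h to ε # ch, where c ≠ 1 is the Fourier partner of the
restriction of χ to Z. So Λ(G) is not normal. The left factor of a semidirect product is always
normal, so the second equivalence follows from the first. -/

namespace DrinfeldDouble

open scoped TensorProduct

/-! ### Group-likes of D(G), and central support of the component k^G → kG. -/

section Components

variable {k : Type*} [Field k] {G : Type*} [Group G] [Fintype G] [DecidableEq G]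

theorem tmul_eq_sum (a : G → k) (h : G) :
    (tmul a h : DrinfeldDouble k G) = ∑ g : G, a g • basisVec g h := by
  refine ext' fun x y => ?_
  have : (∑ g : G, a g • basisVec g h : DrinfeldDouble k G) (x, y) =
      ∑ g : G, (a g • basisVec g h : DrinfeldDouble k G) (x, y) := Finset.sum_apply _ _ _
  rw [this]
  simp [smul_apply, basisVec_apply, ite_and, tmul]

theorem basisVec_one_mul (g h : G) :
    (basisVec g 1 * tmul 1 h : DrinfeldDouble k G) = basisVec g h :=
  (basisVec_eq_mul g h).symm

theorem tmul_mul_tmul_one (a : G → k) (h : G) :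
    (tmul a 1 * tmul 1 h : DrinfeldDouble k G) = tmul a h := by
  rw [tmul_eq_sum a, tmul_eq_sum a, Finset.sum_mul]
  simp only [smul_mul_assoc, basisVec_one_mul]

theorem tmul_one_mul_basisVec (g h : G) :
    (tmul 1 h * basisVec g 1 : DrinfeldDouble k G) = basisVec (h * g * h⁻¹) h := by
  rw [tmul_one_eq, Finset.sum_mul]
  simp [basisVec_mul]

/-- Comultiplicativity is always used through these coordinates; the first tensor factor carries the
right-hand factor of the product `a * b` because of the co-opposite. -/
theorem coeff_tmul_coeff_comul (x : DrinfeldDouble k G) (a b h h' : G) :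
    LinearMap.mul' k k (TensorProduct.map (coeff (b, h)) (coeff (a, h'))
      (CoalgebraStruct.comul (R := k) x)) = if h = h' then x (a * b, h) else 0 := by
  have : (LinearMap.mul' k k ∘ₗ TensorProduct.map (coeff (b, h)) (coeff (a, h'))) ∘ₗ
      CoalgebraStruct.comul = if h = h' then
        (coeff (a * b, h) : DrinfeldDouble k G →ₗ[k] k) else 0 := by
    refine linearMap_ext fun g l => ?_
    simp only [LinearMap.comp_apply, comul_basisVec, map_sum, TensorProduct.map_tmul,
      LinearMap.mul'_apply, coeff_apply, basisVec_apply]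
    rw [Finset.sum_eq_single a]
    · have h1 : b = a⁻¹ * g ↔ a * b = g := by rw [eq_inv_mul_iff_mul_eq]
      by_cases hh : h = h'
      · subst hh
        by_cases hl : h = l <;> simp [coeff_apply, basisVec_apply, h1, hl]
      · rw [if_neg hh, LinearMap.zero_apply]
        by_cases hl : h = l
        · subst hl; simp [Ne.symm hh]
        · simp [hl]
    · intro c _ hc; simp [hc.symm]
    · simp
  have := LinearMap.congr_fun this x
  rw [LinearMap.comp_apply, LinearMap.comp_apply] at this
  rw [this]
  split_ifs <;> rfl

/-- A group-like element of `D(G)` is `χ # g` for a linear character `χ` and some `g ∈ G`. -/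
theorem exists_eq_tmul_of_comul (y : DrinfeldDouble k G)
    (h1 : CoalgebraStruct.comul (R := k) y = y ⊗ₜ[k] y)
    (h2 : CoalgebraStruct.counit (R := k) y = 1) :
    ∃ (χ : G →* kˣ) (g : G), y = tmul (fun x => (χ x : k)) g := by
  have key : ∀ a b h h', y (b, h) * y (a, h') = if h = h' then y (a * b, h) else 0 := by
    intro a b h h'
    rw [← coeff_tmul_coeff_comul, h1, TensorProduct.map_tmul]
    rfl
  rw [counit_apply] at h2
  obtain ⟨g, hg⟩ : ∃ g, y (1, g) ≠ 0 := by
    by_contra! hc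
    simp [hc] at h2
  have hz : ∀ a h, h ≠ g → y (a, h) = 0 := by
    intro a h hh
    have := key a 1 g h
    rw [if_neg hh.symm] at this
    exact (mul_eq_zero.1 this).resolve_left hg
  have h3 : y (1, g) = 1 := by
    rw [Finset.sum_eq_single g (fun b _ hb => hz 1 b hb) (by simp)] at h2
    exact h2
  have h4 : ∀ a b, y (a * b, g) = y (a, g) * y (b, g) := by
    intro a b
    rw [mul_comm, key, if_pos rfl]
  -- `key` confines `y` to the column of `g`, where it is multiplicative; its values are units
  -- because G is a group.
  let χ : G →* k := { toFun := fun a => y (a, g), map_one' := h3, map_mul' := h4 }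
  refine ⟨χ.toHomUnits, g, ext' fun a l => ?_⟩
  by_cases hl : l = g
  · subst hl; simp [tmul, χ]
  · simp [tmul, hl, hz]

variable (ψ : DrinfeldDouble k G ≃ₐc[k] DrinfeldDouble k G)

theorem exists_map_tmul_one (h : G) : ∃ (χ : G →* kˣ) (g : G),
    ψ (tmul 1 h) = tmul (fun x => (χ x : k)) g := by
  refine exists_eq_tmul_of_comul _ ?_ ?_
  · rw [← CoalgHomClass.map_comp_comul_apply, comul_tmul_one, TensorProduct.map_tmul]
    rfl
  · rw [CoalgHomClass.counit_comp_apply, counit_apply]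
    simp [tmul]

theorem tmul_char_mul (χ χ' : G →* kˣ) (g g' : G) :
    (tmul (fun x => (χ x : k)) g * tmul (fun x => (χ' x : k)) g' : DrinfeldDouble k G) =
      tmul (fun x => ((χ * χ') x : k)) (g * g') := by
  refine ext' fun a l => ?_
  simp only [mul_apply, tmul]
  rw [Finset.sum_eq_single g (by intro b _ hb; simp [hb]) (by simp)]
  simp [inv_mul_eq_iff_eq_mul, mul_comm (χ' g)⁻¹]

theorem tmul_char_inj {χ χ' : G →* kˣ} {g g' : G}
    (h : (tmul (fun x => (χ x : k)) g : DrinfeldDouble k G) = tmul (fun x => (χ' x : k)) g') :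
    χ = χ' ∧ g = g' := by
  have h1 : ∀ a l, (if l = g then (χ a : k) else 0) = if l = g' then (χ' a : k) else 0 :=
    fun a l => congrFun h (a, l)
  have hg : g = g' := by
    by_contra hne
    have := h1 1 g
    simp [hne] at this
  subst hg
  refine ⟨MonoidHom.ext fun a => Units.ext ?_, rfl⟩
  simpa using h1 a g

theorem tmul_one_mul_tmul_one (a b : G) :
    (tmul 1 a * tmul 1 b : DrinfeldDouble k G) = tmul 1 (a * b) := by
  have := tmul_char_mul (k := k) (1 : G →* kˣ) 1 a b
  simpa using! this

/-- The action of `ψ` on the group-like elements `ε # h`. -/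
noncomputable def groupLikeComp : G →* (G →* kˣ) × G where
  toFun h := ((exists_map_tmul_one ψ h).choose, (exists_map_tmul_one ψ h).choose_spec.choose)
  map_one' := by
    have h1 := (exists_map_tmul_one ψ 1).choose_spec.choose_spec
    have h2 : ψ (tmul 1 1) = tmul (fun x => ((1 : G →* kˣ) x : k)) 1 := map_one ψ
    exact Prod.ext_iff.2 (tmul_char_inj (h1.symm.trans h2))
  map_mul' a b := by
    have h1 := (exists_map_tmul_one ψ (a * b)).choose_spec.choose_spec
    have h2 : ψ (tmul 1 (a * b)) = ψ (tmul 1 a) * ψ (tmul 1 b) := by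
      rw [← map_mul, tmul_one_mul_tmul_one]
    have h3 := h1.symm.trans h2
    rw [(exists_map_tmul_one ψ a).choose_spec.choose_spec,
      (exists_map_tmul_one ψ b).choose_spec.choose_spec, tmul_char_mul] at h3
    exact Prod.ext_iff.2 (tmul_char_inj h3)

/-- The component `kG → k^G` of `ψ`, as a bicharacter. -/
noncomputable def charComp : G →* G →* kˣ := (MonoidHom.fst _ _).comp (groupLikeComp ψ)

/-- The component `kG → kG` of `ψ`, as an endomorphism of `G`. -/
noncomputable def groupComp : G →* G := (MonoidHom.snd _ _).comp (groupLikeComp ψ)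

theorem map_tmul_one (h : G) :
    ψ (tmul 1 h) = tmul (fun x => (charComp ψ h x : k)) (groupComp ψ h) :=
  (exists_map_tmul_one ψ h).choose_spec.choose_spec

theorem map_basisVec_mul_apply (g l a b h h' : G) :
    (∑ c : G, ψ (basisVec (c⁻¹ * g) l) (b, h) * ψ (basisVec c l) (a, h')) =
      if h = h' then ψ (basisVec g l) (a * b, h) else 0 := by
  rw [← coeff_tmul_coeff_comul, ← CoalgHomClass.map_comp_comul_apply, comul_basisVec, map_sum,
    map_sum, map_sum]
  rfl

/-! ### The dual of the restriction of `ψ` to `k^G` -/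

theorem sum_single_mul_sum_single (f f' : G → k) :
    (∑ g, MonoidAlgebra.single g (f g)) * (∑ g, MonoidAlgebra.single g (f' g)) =
      ∑ g, MonoidAlgebra.single g (∑ c, f c * f' (c⁻¹ * g)) := by
  have (g : G) : MonoidAlgebra.single g (∑ c, f c * f' (c⁻¹ * g)) =
      ∑ c, MonoidAlgebra.single g (f c * f' (c⁻¹ * g)) :=
    map_sum (MonoidAlgebra.singleAddHom g) _ _
  simp only [this]
  rw [Finset.sum_comm, Finset.sum_mul_sum]
  refine Finset.sum_congr rfl fun c _ => ?_
  refine Fintype.sum_equiv (Equiv.mulLeft c) _ _ fun d => ?_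
  simp [MonoidAlgebra.single_mul_single]

/-- The functional `a ↦ ψ(a # 1) (x, h)` on `k^G`, as an element of `kG`. -/
noncomputable def dualCoeff (x h : G) : MonoidAlgebra k G :=
  ∑ g : G, MonoidAlgebra.single g (ψ (basisVec g 1) (x, h))

theorem coeff_dualCoeff (x h g : G) :
    (dualCoeff ψ x h).coeff g = ψ (basisVec g 1) (x, h) := by
  simp [dualCoeff, Finsupp.single_apply]

/-- Comultiplicativity of `ψ`, transposed: the dual of the restriction to k^G is multiplicative. In
particular the `dualCoeff ψ 1 h` are orthogonal idempotents. -/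
theorem dualCoeff_mul (a b h h' : G) :
    dualCoeff ψ a h' * dualCoeff ψ b h = if h = h' then dualCoeff ψ (a * b) h else 0 := by
  rw [dualCoeff, dualCoeff, sum_single_mul_sum_single]
  simp only [mul_comm (ψ (basisVec _ 1) (a, h'))]
  simp only [map_basisVec_mul_apply]
  split_ifs
  · rfl
  · simp

/-- Transpose of the injectivity of `ψ` on k^G: a functional vanishing on the span is a function `a`
with ψ(a # 1) = 0. -/
theorem span_dualCoeff :
    Submodule.span k (Set.range fun p : G × G => dualCoeff ψ p.1 p.2) = ⊤ := by
  by_contra hne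
  obtain ⟨f, hf0, hf⟩ := Submodule.exists_le_ker_of_lt_top _ (lt_top_iff_ne_top.2 hne)
  apply hf0
  let a : G → k := fun g => f (MonoidAlgebra.single g 1)
  have h1 : ψ (tmul a 1) = 0 := by
    refine ext' fun x h => ?_
    have h2 : f (dualCoeff ψ x h) = 0 :=
      hf (Submodule.subset_span ⟨(x, h), rfl⟩)
    have h3 : ψ (tmul a 1) (x, h) = ∑ g : G, a g * ψ (basisVec g 1) (x, h) := by
      rw [tmul_eq_sum, map_sum, ← coeff_apply (x, h) (∑ g, _), map_sum]
      simp [coeff_apply]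
    rw [h3, zero_apply, ← h2, dualCoeff, map_sum]
    refine Finset.sum_congr rfl fun g _ => ?_
    rw [show MonoidAlgebra.single g (ψ (basisVec g 1) (x, h)) =
      ψ (basisVec g 1) (x, h) • MonoidAlgebra.single g (1 : k) by simp, map_smul, smul_eq_mul,
      mul_comm]
  have h4 : (tmul a 1 : DrinfeldDouble k G) = 0 := (EmbeddingLike.map_eq_zero_iff (f := ψ)).1 h1
  have h5 : ∀ g, a g = 0 := by
    intro g
    have := congrFun h4 (g, 1)
    simpa [tmul, zero_apply] using! this
  refine MonoidAlgebra.lhom_ext' fun g => LinearMap.ext_ring ?_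
  exact h5 g

/-- By `dualCoeff_mul` it commutes with a spanning set, hence is central in kG; its coefficients are
therefore class functions. -/
theorem commute_dualCoeff_one (h : G) (x : MonoidAlgebra k G) :
    Commute x (dualCoeff ψ 1 h) := by
  have hx : x ∈ Submodule.span k (Set.range fun p : G × G => dualCoeff ψ p.1 p.2) := by
    rw [span_dualCoeff]; trivial
  induction hx using Submodule.span_induction with
  | mem x hx =>
    obtain ⟨⟨a, l⟩, rfl⟩ := hx
    change dualCoeff ψ a l * dualCoeff ψ 1 h = dualCoeff ψ 1 h * dualCoeff ψ a l
    rw [dualCoeff_mul, dualCoeff_mul]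
    by_cases hl : h = l
    · subst hl; simp
    · simp [hl, Ne.symm hl]
  | zero => exact Commute.zero_left _
  | add x y _ _ hx hy => exact hx.add_left hy
  | smul c x _ hx => exact hx.smul_left c

theorem coeff_conj_of_commute {x : MonoidAlgebra k G} {y : G}
    (h : Commute (MonoidAlgebra.single y 1) x) (g : G) :
    x.coeff (y * g * y⁻¹) = x.coeff g := by
  have h1 := congrArg (fun z : MonoidAlgebra k G => z.coeff (y * g)) h.eq
  simpa using h1.symm

theorem map_basisVec_conj_apply_one (y g h : G) :
    ψ (basisVec (y * g * y⁻¹) 1) (1, h) = ψ (basisVec g 1) (1, h) := by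
  rw [← coeff_dualCoeff, ← coeff_dualCoeff]
  exact coeff_conj_of_commute (commute_dualCoeff_one ψ h _) g

/-! ### The component `k^G → kG` -/

theorem coeff_projGroup (x : DrinfeldDouble k G) (l : G) :
    (projGroup x).coeff l = x (1, l) := by
  simp [projGroup, Finsupp.single_apply]

theorem projGroup_mul (x y : DrinfeldDouble k G) :
    projGroup (x * y) = projGroup x * projGroup y := by
  rw [projGroup, projGroup, projGroup, sum_single_mul_sum_single]
  simp [mul_apply]

theorem projGroup_tmul_char (χ : G →* kˣ) (g : G) :
    projGroup (tmul (fun x => (χ x : k)) g : DrinfeldDouble k G) = MonoidAlgebra.single g 1 := by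
  rw [projGroup_eq_single_iff]
  intro l
  simp [tmul]

theorem basisVec_one_mul_basisVec_one (g h : G) :
    (basisVec g 1 * basisVec h 1 : DrinfeldDouble k G) =
      if g = h then basisVec g 1 else 0 := by
  simp [basisVec_mul]

theorem projGroup_zero : projGroup (0 : DrinfeldDouble k G) = 0 := by
  ext l
  rw [coeff_projGroup]
  rfl

/-- p is constant on the conjugacy class of g, yet distinct conjugates give orthogonal idempotents.
If g has a conjugate g' ≠ g, then p(e_g) = p(e_g) p(e_g) = p(e_g) p(e_g') = 0. -/
theorem mem_center_of_projGroup_ne_zero {g : G} (h : projGroup (ψ (basisVec g 1)) ≠ 0) :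
    g ∈ Subgroup.center G := by
  rw [Subgroup.mem_center_iff]
  intro y
  by_contra hne
  apply h
  have h1 : projGroup (ψ (basisVec (y * g * y⁻¹) 1)) = projGroup (ψ (basisVec g 1)) := by
    ext l
    rw [coeff_projGroup, coeff_projGroup, map_basisVec_conj_apply_one]
  have h2 : ψ (basisVec g 1) * ψ (basisVec (y * g * y⁻¹) 1) = 0 := by
    rw [← map_mul, basisVec_one_mul_basisVec_one, if_neg, map_zero]
    intro h3
    apply hne
    nth_rw 2 [h3]
    group
  have h3 : ψ (basisVec g 1) * ψ (basisVec g 1) = ψ (basisVec g 1) := by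
    rw [← map_mul, basisVec_one_mul_basisVec_one, if_pos rfl]
  rw [← h3, projGroup_mul]
  nth_rw 2 [← h1]
  rw [← projGroup_mul, h2, projGroup_zero]

theorem map_basisVec_eq (g h : G) : ψ (basisVec g h) =
    ψ (basisVec g 1) * tmul (fun x => (charComp ψ h x : k)) (groupComp ψ h) := by
  rw [← map_tmul_one, ← map_mul, basisVec_one_mul]

/-- `projGroup` as a linear map. -/
noncomputable def projGroupLin : DrinfeldDouble k G →ₗ[k] MonoidAlgebra k G where
  toFun := projGroup
  map_add' x y := by ext l; simp [coeff_projGroup, add_apply]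
  map_smul' c x := by ext l; simp [coeff_projGroup, smul_apply]

/-- For central g, e_g # 1 is central in D(G), and `projGroup` after `ψ` is multiplicative and onto
kG. -/
theorem commute_projGroup (g : G) (x : MonoidAlgebra k G) :
    Commute x (projGroup (ψ (basisVec g 1))) := by
  by_cases hg : g ∈ Subgroup.center G
  swap
  · have : projGroup (ψ (basisVec g 1)) = 0 := by
      by_contra h; exact hg (mem_center_of_projGroup_ne_zero ψ h)
    rw [this]; exact Commute.zero_right _
  have key : ∀ z : DrinfeldDouble k G,
      Commute (projGroup (ψ z)) (projGroup (ψ (basisVec g 1))) := by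
    intro z
    change projGroup (ψ z) * projGroup (ψ (basisVec g 1)) =
      projGroup (ψ (basisVec g 1)) * projGroup (ψ z)
    rw [← projGroup_mul, ← projGroup_mul, ← map_mul, ← map_mul]
    congr 2
    have : LinearMap.mulRight k (basisVec g 1 : DrinfeldDouble k G) =
        LinearMap.mulLeft k (basisVec g 1 : DrinfeldDouble k G) := by
      refine linearMap_ext fun a l => ?_
      simp only [LinearMap.mulRight_apply, LinearMap.mulLeft_apply, basisVec_mul]
      rw [Subgroup.mem_center_iff] at hg
      rw [hg l]
      by_cases ha : a = g
      · subst ha; simp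
      · simp [ha, Ne.symm ha]
    exact LinearMap.congr_fun this z
  obtain ⟨y, hy⟩ : ∃ y : DrinfeldDouble k G, projGroup y = x := by
    refine ⟨fun p => x.coeff p.2, ?_⟩
    ext l
    exact coeff_projGroup _ l
  have := key (ψ.symm y)
  rwa [show ψ (ψ.symm y) = y from ψ.apply_symm_apply y, hy] at this

/-- The same argument on the other side: by centrality of p(e_g), conjugate `h` give equal
idempotents, which are also orthogonal when the conjugates differ. -/
theorem dualCoeff_one_eq_zero {h : G} (hh : h ∉ Subgroup.center G) : dualCoeff ψ 1 h = 0 := by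
  rw [Subgroup.mem_center_iff] at hh
  push Not at hh
  obtain ⟨y, hy⟩ := hh
  have h1 : dualCoeff ψ 1 (y * h * y⁻¹) = dualCoeff ψ 1 h := by
    ext g
    rw [coeff_dualCoeff, coeff_dualCoeff, ← coeff_projGroup (ψ (basisVec g 1)),
      ← coeff_projGroup (ψ (basisVec g 1))]
    exact coeff_conj_of_commute (commute_projGroup ψ g _) h
  have h2 := dualCoeff_mul ψ 1 1 h h
  have h3 := dualCoeff_mul ψ 1 1 h (y * h * y⁻¹)
  rw [if_neg, h1, h2, if_pos rfl, mul_one] at h3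
  · exact h3
  · intro h4
    apply hy
    nth_rw 2 [h4]
    group

theorem map_basisVec_one_apply_eq_zero (g a : G) {h : G} (hh : h ∉ Subgroup.center G) :
    ψ (basisVec g 1) (a, h) = 0 := by
  -- `dualCoeff ψ a h` is a multiple of the idempotent `dualCoeff ψ 1 h`, which vanishes.
  have h1 := dualCoeff_mul ψ a 1 h h
  rw [dualCoeff_one_eq_zero ψ hh, mul_zero, if_pos rfl, mul_one] at h1
  rw [← coeff_dualCoeff, ← h1]
  rfl

end Components

end DrinfeldDouble

namespace DrinfeldDouble

open scoped TensorProduct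

/-! ### The endomorphism of G dual to u, and the decomposition for stem groups. -/

section Structure

variable {k : Type*} [Field k] {G : Type*} [Group G] [Fintype G] [DecidableEq G]

/-! ### The component `k^G → k^G` -/

/-- `projDual` as a linear map. -/
def projDualLin : DrinfeldDouble k G →ₗ[k] (G → k) where
  toFun := projDual
  map_add' x y := by funext g; simp [projDual, add_apply, Finset.sum_add_distrib]
  map_smul' c x := by funext g; simp [projDual, smul_apply, Finset.mul_sum]

theorem projDual_tmul (a : G → k) (h : G) : projDual (tmul a h : DrinfeldDouble k G) = a := by
  funext g
  simp [projDual, tmul]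

theorem projDual_basisVec (g h : G) :
    projDual (basisVec g h : DrinfeldDouble k G) = Pi.single g 1 := projDual_tmul _ _

/-- The conjugation twist in the product is invisible when the group part of `x` is central. This
makes u multiplicative on k^G. -/
theorem projDual_mul_of_center {x : DrinfeldDouble k G}
    (hx : ∀ g h, h ∉ Subgroup.center G → x (g, h) = 0) (y : DrinfeldDouble k G) :
    projDual (x * y) = projDual x * projDual y := by
  funext g
  simp only [projDual, mul_apply, Pi.mul_apply]
  rw [Finset.sum_comm, Finset.sum_mul_sum]
  refine Finset.sum_congr rfl fun h _ => ?_
  refine Fintype.sum_equiv (Equiv.mulLeft h⁻¹) _ _ fun l => ?_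
  by_cases hh : h ∈ Subgroup.center G
  · rw [Subgroup.mem_center_iff] at hh
    rw [mul_assoc, hh, inv_mul_cancel_left]
    rfl
  · rw [hx g h hh, zero_mul, zero_mul]

theorem projDual_mul_tmul_char (x : DrinfeldDouble k G) (χ : G →* kˣ) (l : G) :
    projDual (x * tmul (fun y => (χ y : k)) l) = projDual x * fun y => (χ y : k) := by
  have : (tmul (fun y => (χ y : k)) l : DrinfeldDouble k G) =
      tmul (fun y => (χ y : k)) 1 * tmul 1 l := (tmul_mul_tmul_one _ _).symm
  rw [this, ← mul_assoc, projDual_mul_tmul_one]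
  funext g
  simp only [projDual, mul_apply, tmul, Pi.mul_apply, Finset.sum_mul]
  refine Finset.sum_congr rfl fun h _ => ?_
  rw [Finset.sum_eq_single h]
  · simp [mul_comm, mul_assoc]
  · intro b _ hb
    simp [inv_mul_eq_one, hb]
  · simp

theorem projDual_tmul_char_mul (x : DrinfeldDouble k G) (χ : G →* kˣ) (l y : G) :
    projDual (tmul (fun y => (χ y : k)) l * x) y = χ y * projDual x (l⁻¹ * y * l) := by
  simp only [projDual, mul_apply, tmul, ite_mul, zero_mul, Finset.sum_ite_eq', Finset.mem_univ,
    if_true, Finset.mul_sum]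
  exact Fintype.sum_equiv (Equiv.mulLeft l⁻¹) _ _ fun h => rfl

variable (ψ : DrinfeldDouble k G ≃ₐc[k] DrinfeldDouble k G)

theorem projDual_map_basisVec_mul (g g' : G) :
    projDual (ψ (basisVec g 1)) * projDual (ψ (basisVec g' 1)) =
      if g = g' then projDual (ψ (basisVec g 1)) else 0 := by
  rw [← projDual_mul_of_center (fun a h hh => map_basisVec_one_apply_eq_zero ψ g a hh), ← map_mul,
    basisVec_one_mul_basisVec_one]
  split_ifs
  · rfl
  · rw [map_zero]; exact map_zero (projDualLin (k := k) (G := G))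

theorem sum_projDual_map_basisVec : ∑ g, projDual (ψ (basisVec g 1)) = 1 := by
  change ∑ g, projDualLin (ψ (basisVec g 1)) = 1
  rw [← map_sum, ← map_sum, ← one_eq, map_one]
  exact projDual_tmul 1 1

/-- The u(e_g) are orthogonal idempotent functions with sum 1, so exactly one of them is 1 at `y`.
-/
theorem exists_projDual_map_basisVec (y : G) :
    ∃ s, ∀ g, projDual (ψ (basisVec g 1)) y = if s = g then 1 else 0 := by
  have h1 := congrFun (sum_projDual_map_basisVec ψ) y
  rw [Finset.sum_apply] at h1
  obtain ⟨s, hs⟩ : ∃ s, projDual (ψ (basisVec s 1)) y ≠ 0 := by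
    by_contra! hc
    simp [hc] at h1
  have hz : ∀ g, s ≠ g → projDual (ψ (basisVec g 1)) y = 0 := by
    intro g hg
    have := congrFun (projDual_map_basisVec_mul ψ s g) y
    rw [if_neg hg] at this
    exact (mul_eq_zero.1 this).resolve_left hs
  refine ⟨s, fun g => ?_⟩
  split_ifs with hg
  · subst hg
    rw [Finset.sum_eq_single s (fun b _ hb => hz b hb.symm) (by simp)] at h1
    exact h1
  · exact hz g hg

theorem projDual_map_basisVec_mul_apply (g a b : G) :
    projDual (ψ (basisVec g 1)) (a * b) =
      ∑ c, projDual (ψ (basisVec (c⁻¹ * g) 1)) b * projDual (ψ (basisVec c 1)) a := by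
  simp only [projDual, Finset.sum_mul_sum]
  rw [Finset.sum_comm]
  refine Finset.sum_congr rfl fun h _ => ?_
  rw [Finset.sum_comm]
  simp only [map_basisVec_mul_apply]
  simp

/-- The endomorphism of `G` dual to the component `k^G → k^G` of `ψ`. -/
noncomputable def dualComp : G →* G :=
  MonoidHom.mk' (fun y => (exists_projDual_map_basisVec ψ y).choose) fun a b => by
    have h (y : G) := (exists_projDual_map_basisVec ψ y).choose_spec
    -- Test at the product of the two chosen elements: the convolution on the right is 1, while the
    -- left would be 0 if the choice at `a * b` differed.
    have h1 := projDual_map_basisVec_mul_apply ψ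
      ((exists_projDual_map_basisVec ψ a).choose * (exists_projDual_map_basisVec ψ b).choose) a b
    by_contra hne
    rw [h (a * b), if_neg hne, Finset.sum_eq_single (exists_projDual_map_basisVec ψ a).choose,
      h b, h a] at h1
    · simp at h1
    · intro c _ hc
      rw [h a c, if_neg hc.symm, mul_zero]
    · simp

theorem projDual_map_basisVec_one (g y : G) :
    projDual (ψ (basisVec g 1)) y = if dualComp ψ y = g then 1 else 0 :=
  (exists_projDual_map_basisVec ψ y).choose_spec g

theorem projDual_map_basisVec (g h y : G) :
    projDual (ψ (basisVec g h)) y = if dualComp ψ y = g then (charComp ψ h y : k) else 0 := by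
  rw [map_basisVec_eq, projDual_mul_tmul_char, Pi.mul_apply, projDual_map_basisVec_one]
  simp

theorem projDual_map (x : DrinfeldDouble k G) (y : G) :
    projDual (ψ x) y = ∑ h, x (dualComp ψ y, h) * charComp ψ h y := by
  have : LinearMap.proj y ∘ₗ projDualLin ∘ₗ (ψ : DrinfeldDouble k G →ₗ[k] DrinfeldDouble k G) =
      ∑ h, (charComp ψ h y : k) • coeff (dualComp ψ y, h) := by
    refine linearMap_ext fun g l => ?_
    simp only [LinearMap.sum_apply, LinearMap.smul_apply, coeff_apply, basisVec_apply, smul_eq_mul]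
    refine (projDual_map_basisVec ψ g l y).trans ?_
    by_cases hg : dualComp ψ y = g <;> simp [hg]
  have := LinearMap.congr_fun this x
  simp only [LinearMap.sum_apply, LinearMap.smul_apply, coeff_apply, smul_eq_mul] at this
  refine Eq.trans this ?_
  exact Finset.sum_congr rfl fun h _ => mul_comm _ _

theorem dualComp_unique {s : G → G}
    (h : ∀ g y, projDual (ψ (basisVec g 1)) y = if s y = g then 1 else 0) (y : G) :
    dualComp ψ y = s y := by
  have h1 := h (dualComp ψ y) y
  rw [projDual_map_basisVec_one, if_pos rfl] at h1
  by_contra hne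
  rw [if_neg (Ne.symm hne)] at h1
  exact one_ne_zero h1

/-- Apply `ψ` to the straightening relation between ε # h and e_g # 1 and compare k^G-components at
`y`. This becomes the condition defining SpAut_c(G). -/
theorem dualComp_conj (h y : G) :
    dualComp ψ ((groupComp ψ h)⁻¹ * y * groupComp ψ h) = h⁻¹ * dualComp ψ y * h := by
  have h1 := congrArg (fun x => projDual (ψ x) y)
    (tmul_one_mul_basisVec (k := k) (h⁻¹ * dualComp ψ y * h) h)
  simp only [map_mul ψ, map_tmul_one, projDual_tmul_char_mul, projDual_map_basisVec] at h1
  by_contra hne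
  rw [if_neg hne, mul_zero, if_pos (by group)] at h1
  exact (Units.ne_zero _) h1.symm

/-! ### Stem groups -/

theorem map_center_eq_one (hG : IsStemGroup G) {A : Type*} [CommGroup A] (f : G →* A) {z : G}
    (hz : z ∈ Subgroup.center G) : f z = 1 := by
  have : commutator G ≤ f.ker := Abelianization.commutator_subset_ker f
  exact this (hG hz)

theorem charComp_of_mem_center (hG : IsStemGroup G) {h : G} (hh : h ∈ Subgroup.center G) :
    charComp ψ h = 1 :=
  map_center_eq_one hG _ hh

/-- The k^G-component of a composite has an extra contribution of r after p; p lands on the centre,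
where r is trivial. The order reverses because `dualComp` is dual to u. -/
theorem dualComp_mul (hG : IsStemGroup G) (φ : DrinfeldDouble k G ≃ₐc[k] DrinfeldDouble k G)
    (y : G) : dualComp (ψ * φ) y = dualComp φ (dualComp ψ y) := by
  refine dualComp_unique _ (s := fun y => dualComp φ (dualComp ψ y)) (fun g y => ?_) y
  rw [BialgEquiv.aut_mul_apply, projDual_map, ← projDual_map_basisVec_one, projDual]
  refine Finset.sum_congr rfl fun h _ => ?_
  by_cases hh : h ∈ Subgroup.center G
  · simp [charComp_of_mem_center ψ hG hh]
  · rw [map_basisVec_one_apply_eq_zero φ g _ hh, zero_mul]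

theorem dualComp_one (y : G) : dualComp (1 : DrinfeldDouble k G ≃ₐc[k] DrinfeldDouble k G) y = y :=
  dualComp_unique _ (s := fun y => y) (fun g y => by
    rw [BialgEquiv.aut_one_apply, projDual_basisVec]
    simp [Pi.single_apply]) y

theorem dualComp_bijective (hG : IsStemGroup G) : Function.Bijective (dualComp ψ) := by
  refine Finite.surjective_iff_bijective.1 fun y => ⟨dualComp ψ⁻¹ y, ?_⟩
  rw [← dualComp_mul _ hG, inv_mul_cancel, dualComp_one]

/-- Triviality of p after r: p sees only central g, where χ(g) = 1, so χ may be replaced by ε. -/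
theorem projGroup_map_tmul_char (hG : IsStemGroup G) (χ : G →* kˣ) :
    projGroup (ψ (tmul (fun x => (χ x : k)) 1)) = 1 := by
  have h1 : ∀ g, projGroupLin (ψ ((χ g : k) • basisVec g 1)) =
      projGroupLin (ψ (basisVec g 1)) := by
    intro g
    rw [map_smul, map_smul]
    by_cases hg : g ∈ Subgroup.center G
    · simp [map_center_eq_one hG χ hg]
    · have : projGroupLin (ψ (basisVec g 1)) = 0 := by
        by_contra h; exact hg (mem_center_of_projGroup_ne_zero ψ h)
      rw [this, smul_zero]
  change projGroupLin _ = 1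
  rw [tmul_eq_sum, map_sum, map_sum]
  simp only [h1]
  rw [← map_sum, ← map_sum, ← one_eq, map_one]
  exact (projGroup_eq_single_iff _ _).2 fun l => rfl

theorem groupComp_bijective (hG : IsStemGroup G) : Function.Bijective (groupComp ψ) := by
  refine Finite.surjective_iff_bijective.1 fun y => ⟨groupComp ψ⁻¹ y, ?_⟩
  have h1 : ψ (ψ⁻¹ (tmul 1 y)) = tmul 1 y := BialgEquiv.aut_apply_inv ψ _
  rw [map_tmul_one ψ⁻¹, ← tmul_mul_tmul_one, map_mul, map_tmul_one] at h1
  have h2 := congrArg projGroup h1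
  rw [projGroup_mul, projGroup_map_tmul_char ψ hG, projGroup_tmul_char, one_mul] at h2
  have h3 := projGroup_tmul_char (k := k) 1 y
  have h4 := h2.trans h3
  have := congrArg (fun x : MonoidAlgebra k G => x.coeff y) h4
  by_contra hne
  simp [hne] at this

/-- A group-like is determined by its two projections. `l` preserves the k^G-projection by
definition, and the kG-projection because p of a character is 1. -/
theorem map_tmul_char_of_mem_Lambda (hG : IsStemGroup G)
    {l : DrinfeldDouble k G ≃ₐc[k] DrinfeldDouble k G}
    (hl : l ∈ Lambda k G) (h : G) : l (ψ (tmul 1 h)) = ψ (tmul 1 h) := by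
  obtain ⟨h1, h2⟩ := (comp_trivial_iff l).1 hl
  have h3 := map_tmul_one (l * ψ) h
  rw [BialgEquiv.aut_mul_apply] at h3
  have h4 := h1 (ψ (tmul 1 h))
  have h5 : projGroup (l (ψ (tmul 1 h))) = MonoidAlgebra.single (groupComp ψ h) 1 := by
    rw [map_tmul_one, ← tmul_mul_tmul_one, map_mul, h2, projGroup_mul,
      projGroup_map_tmul_char l hG, one_mul]
    exact projGroup_tmul_char (k := k) 1 _
  rw [h3, projGroup_tmul_char] at h5
  rw [h3, map_tmul_one, projDual_tmul, projDual_tmul] at h4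
  have h6 : groupComp (l * ψ) h = groupComp ψ h := by
    by_contra hne
    have := congrArg (fun x : MonoidAlgebra k G => x.coeff (groupComp ψ h)) h5
    simp [hne] at this
  rw [h3, map_tmul_one, h4, h6]

theorem mem_Lambda_iff : ψ ∈ Lambda k G ↔
    (∀ y, dualComp ψ y = y) ∧ ∀ h, ψ (tmul 1 h) = tmul 1 h := by
  refine (comp_trivial_iff ψ).trans ⟨fun h => ⟨fun y => ?_, h.2⟩, fun h => ⟨fun x => ?_, h.2⟩⟩
  · refine dualComp_unique _ (s := fun y => y) (fun g y => ?_) y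
    rw [h.1, projDual_basisVec]
    simp [Pi.single_apply]
  · funext y
    have h1 : ∀ l, charComp ψ l = 1 := by
      intro l
      have h2 := (map_tmul_one ψ l).symm.trans (h.2 l)
      have h3 : (tmul 1 l : DrinfeldDouble k G) = tmul (fun x => ((1 : G →* kˣ) x : k)) l := rfl
      exact (tmul_char_inj (h2.trans h3)).1
    rw [projDual_map, h.1]
    simp [h1, projDual]

theorem Lambda_normal (hG : IsStemGroup G) : (Lambda k G).Normal := by
  refine ⟨fun l hl ψ => ?_⟩
  rw [mem_Lambda_iff]
  refine ⟨fun y => ?_, fun h => ?_⟩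
  · rw [dualComp_mul _ hG, dualComp_mul _ hG, ((mem_Lambda_iff l).1 hl).1, ← dualComp_mul _ hG,
      mul_inv_cancel, dualComp_one]
  · rw [BialgEquiv.aut_mul_apply, BialgEquiv.aut_mul_apply, map_tmul_char_of_mem_Lambda _ hG hl,
      BialgEquiv.aut_apply_inv]

theorem bchSplitHom_tmul_one (x : BChSplit G k) (h : G) :
    bchSplitHom x (tmul 1 h : DrinfeldDouble k G) =
      tmul (fun y => (x.left (x.right.1.2 h) y : k)) (x.right.1.2 h) := by
  rw [tmul_eq_sum, tmul_eq_sum, map_sum]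
  refine Fintype.sum_equiv x.right.1.1.toEquiv _ _ fun g => ?_
  rw [Pi.one_apply, one_smul]
  exact bchSplitHom_basisVec x g h

theorem dualComp_bchSplitHom (x : BChSplit G k) (y : G) :
    dualComp (bchSplitHom x : DrinfeldDouble k G ≃ₐc[k] DrinfeldDouble k G) y =
      x.right.1.1⁻¹ y := by
  refine dualComp_unique _ (s := fun y => x.right.1.1⁻¹ y) (fun g y => ?_) y
  rw [bchSplitHom_basisVec]
  refine (congrFun (projDualLin.map_smul _ _) y).trans ?_
  change _ * projDual _ y = _
  rw [projDual_basisVec, Pi.single_apply]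
  have : y = x.right.1.1 g ↔ x.right.1.1⁻¹ y = g := by
    rw [← x.right.1.1.symm_apply_eq]; rfl
  simp [this]

theorem bchSplitHom_mem_Lambda_iff (x : BChSplit G k) :
    (bchSplitHom x : DrinfeldDouble k G ≃ₐc[k] DrinfeldDouble k G) ∈ Lambda k G ↔ x = 1 := by
  refine ⟨fun hx => ?_, fun hx => by rw [hx, map_one]; exact one_mem _⟩
  obtain ⟨h1, h2⟩ := (mem_Lambda_iff _).1 hx
  have h3 : ∀ h, x.left (x.right.1.2 h) = 1 ∧ x.right.1.2 h = h := fun h =>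
    tmul_char_inj (χ' := 1) ((bchSplitHom_tmul_one x h).symm.trans (h2 h))
  refine SemidirectProduct.ext (MonoidHom.ext fun h => ?_) (Subtype.ext (Prod.ext ?_ ?_))
  · have := (h3 h).1
    rwa [(h3 h).2] at this
  · refine MulEquiv.ext fun y => ?_
    have := h1 (x.right.1.1 y)
    rw [dualComp_bchSplitHom, MulAut.inv_apply_self] at this
    exact this.symm
  · exact MulEquiv.ext fun h => (h3 h).2

/-- Membership in Λ(G) depends only on (u, r, v), so it suffices to find an element of the embedded
subgroup with the same three components as `ψ`. -/
theorem exists_inv_bchSplitHom_mul_mem_Lambda (hG : IsStemGroup G) :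
    ∃ x : BChSplit G k, (bchSplitHom x)⁻¹ * ψ ∈ Lambda k G := by
  let σ : MulAut G := MulEquiv.ofBijective (dualComp ψ) (dualComp_bijective ψ hG)
  let v : MulAut G := MulEquiv.ofBijective (groupComp ψ) (groupComp_bijective ψ hG)
  have hq : (σ⁻¹, v) ∈ splitCentralAut G := by
    change σ⁻¹⁻¹ * v ∈ centralAut G
    rw [inv_inv]
    refine Subgroup.mem_centralizer_iff.2 ?_
    rintro _ ⟨g, rfl⟩
    refine MulEquiv.ext fun y => ?_
    change g * dualComp ψ (groupComp ψ y) * g⁻¹ = dualComp ψ (groupComp ψ (g * y * g⁻¹))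
    have := dualComp_conj ψ g (groupComp ψ (g * y * g⁻¹))
    rw [← map_inv, ← map_mul, ← map_mul] at this
    rw [show g⁻¹ * (g * y * g⁻¹) * g = y by group] at this
    rw [this]
    group
  -- w is inverse to `σ` because u is dual to it; `v⁻¹` compensates for the embedding evaluating the
  -- bicharacter at v(h).
  let x : BChSplit G k := ⟨(charComp ψ).comp v⁻¹.toMonoidHom, ⟨(σ⁻¹, v), hq⟩⟩
  refine ⟨x, (mem_Lambda_iff _).2 ⟨fun y => ?_, fun h => ?_⟩⟩
  · rw [dualComp_mul _ hG, ← map_inv, dualComp_bchSplitHom]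
    change σ ((x⁻¹).right.1.1⁻¹ y) = y
    have : (x⁻¹).right.1.1⁻¹ = σ⁻¹ := by simp [x]
    rw [this, MulAut.apply_inv_self]
  · have h1 : ψ (tmul 1 h) = bchSplitHom x (tmul 1 h) := by
      rw [map_tmul_one, bchSplitHom_tmul_one]
      change _ = tmul (fun y => (charComp ψ (v⁻¹ (v h)) y : k)) (v h)
      rw [MulAut.inv_apply_self]
      rfl
    rw [BialgEquiv.aut_mul_apply, h1]
    exact (bchSplitHom x).symm_apply_apply _

end Structure

end DrinfeldDouble

namespace DrinfeldDouble

open scoped TensorProduct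

/-! ### Elements of Λ(G) built from Hopf maps k^Z → kZ. -/

section CentralPairing

variable {k : Type*} [Field k] {G : Type*} [Group G] [Fintype G] [DecidableEq G]

/-- The matrix of a Hopf algebra map `k^Z → kZ`, for `Z` the centre of `G`. -/
structure CentralPairing (k : Type*) [Field k] (G : Type*) [Group G] [Fintype G]
    [DecidableEq G] where
  /-- the matrix entries -/
  toFun : Subgroup.center G → Subgroup.center G → k
  mul_right : ∀ z z' e, ∑ c, toFun z c * toFun z' (c⁻¹ * e) = if z = z' then toFun z e else 0
  mul_left : ∀ c c' w, ∑ z, toFun z c * toFun (z⁻¹ * w) c' = if c = c' then toFun w c else 0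
  sum_left : ∀ c, ∑ z, toFun z c = if c = 1 then 1 else 0
  sum_right : ∀ z, ∑ c, toFun z c = if z = 1 then 1 else 0

theorem center_mul_comm (c : Subgroup.center G) (x : Subgroup.center G) : x * c = c * x :=
  Subtype.ext (Subgroup.mem_center_iff.1 c.2 x)

theorem mul_coe_center (z : Subgroup.center G) (x : G) : x * (z : G) = z * x :=
  Subgroup.mem_center_iff.1 z.2 x

/-- Precomposition with the antipode. -/
def CentralPairing.inv (Q : CentralPairing k G) : CentralPairing k G where
  toFun z c := Q.toFun z c⁻¹
  mul_right z z' e := by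
    rw [← Q.mul_right z z' e⁻¹]
    refine Fintype.sum_equiv (Equiv.inv _) _ _ fun c => ?_
    simp [center_mul_comm c e⁻¹]
  mul_left c c' w := by
    rw [Q.mul_left]
    simp
  sum_left c := by rw [Q.sum_left]; simp
  sum_right z := by
    rw [← Q.sum_right z]
    exact Fintype.sum_equiv (Equiv.inv _) _ _ fun c => rfl

/-- The linear map `e_g # h ↦ ∑ Q(z, c) e_{z⁻¹ g} # c h`. -/
def centralMap (Q : CentralPairing k G) : DrinfeldDouble k G →ₗ[k] DrinfeldDouble k G where
  toFun x p := ∑ z : Subgroup.center G, ∑ c : Subgroup.center G,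
    Q.toFun z c * x ((z : G) * p.1, (c : G)⁻¹ * p.2)
  map_add' x y := by
    refine ext' fun g h => ?_
    simp only [add_apply, mul_add, Finset.sum_add_distrib]
    rfl
  map_smul' a x := by
    refine ext' fun g h => ?_
    simp only [smul_apply, mul_left_comm _ a, ← Finset.mul_sum]
    rfl

theorem centralMap_basisVec (Q : CentralPairing k G) (g h : G) :
    centralMap Q (basisVec g h) = ∑ z : Subgroup.center G, ∑ c : Subgroup.center G,
      Q.toFun z c • basisVec ((z : G)⁻¹ * g) ((c : G) * h) := by
  refine ext' fun a b => ?_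
  rw [← coeff_apply (a, b) (∑ z, _), map_sum]
  simp only [map_sum, map_smul, coeff_apply, smul_eq_mul, basisVec_apply]
  change (∑ z : Subgroup.center G, ∑ c : Subgroup.center G,
    Q.toFun z c * (basisVec g h : DrinfeldDouble k G) ((z : G) * a, (c : G)⁻¹ * b)) = _
  simp only [basisVec_apply, inv_mul_eq_iff_eq_mul, eq_inv_mul_iff_mul_eq]

/-- Convolution with the antipode: after the substitution w = z z', `mul_left` forces c' = c⁻¹, and
`sum_right` then leaves only w = 1. -/
theorem centralMap_inv (Q Q' : CentralPairing k G) (hQ : ∀ z c, Q'.toFun z c = Q.toFun z c⁻¹)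
    (x : DrinfeldDouble k G) : centralMap Q' (centralMap Q x) = x := by
  have : centralMap Q' ∘ₗ centralMap Q = LinearMap.id := by
    refine linearMap_ext fun g h => ?_
    simp only [LinearMap.comp_apply, LinearMap.id_apply, centralMap_basisVec, map_sum, map_smul,
      Finset.smul_sum, smul_smul]
    calc _ = ∑ z : Subgroup.center G, ∑ c : Subgroup.center G, ∑ c' : Subgroup.center G,
          ∑ w : Subgroup.center G, (Q.toFun z c * Q.toFun (z⁻¹ * w) c'⁻¹) •
            basisVec ((w : G)⁻¹ * g) (c' * (c * h)) := by
          refine Finset.sum_congr rfl fun z _ => Finset.sum_congr rfl fun c _ => ?_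
          rw [Finset.sum_comm]
          refine Finset.sum_congr rfl fun c' _ =>
            Fintype.sum_equiv (Equiv.mulLeft z) _ _ fun z' => ?_
          simp [hQ, mul_assoc]
      _ = ∑ c : Subgroup.center G, ∑ c' : Subgroup.center G, ∑ w : Subgroup.center G,
          (∑ z, Q.toFun z c * Q.toFun (z⁻¹ * w) c'⁻¹) •
            basisVec ((w : G)⁻¹ * g) (c' * (c * h)) := by
          rw [Finset.sum_comm]
          refine Finset.sum_congr rfl fun c _ => ?_
          rw [Finset.sum_comm]
          refine Finset.sum_congr rfl fun c' _ => ?_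
          rw [Finset.sum_comm]
          simp only [Finset.sum_smul]
      _ = ∑ c : Subgroup.center G, ∑ w : Subgroup.center G,
          Q.toFun w c • basisVec ((w : G)⁻¹ * g) h := by
          refine Finset.sum_congr rfl fun c _ => ?_
          rw [Finset.sum_eq_single c⁻¹]
          · simp [Q.mul_left]
          · intro c' _ hc
            refine Finset.sum_eq_zero fun w _ => ?_
            rw [Q.mul_left, if_neg, zero_smul]
            rintro rfl
            simp at hc
          · simp
      _ = _ := by
          rw [Finset.sum_comm]
          simp only [← Finset.sum_smul, Q.sum_right]
          simp
  exact LinearMap.congr_fun this x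

theorem CentralPairing.sum_smul_mul_right {M : Type*} [AddCommGroup M] [Module k M]
    (Q : CentralPairing k G) (X : Subgroup.center G → M) (z y : Subgroup.center G) :
    ∑ c, ∑ d, (Q.toFun z c * Q.toFun y d) • X (c * d) =
      if z = y then ∑ e, Q.toFun z e • X e else 0 := by
  calc _ = ∑ c, ∑ e, (Q.toFun z c * Q.toFun y (c⁻¹ * e)) • X e :=
        Finset.sum_congr rfl fun c _ =>
          Fintype.sum_equiv (Equiv.mulLeft c) _ _ fun d => by simp
    _ = _ := by
        rw [Finset.sum_comm]
        simp only [← Finset.sum_smul, Q.mul_right]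
        split_ifs <;> simp

theorem CentralPairing.sum_smul_mul_left {M : Type*} [AddCommGroup M] [Module k M]
    (Q : CentralPairing k G) (X : Subgroup.center G → Subgroup.center G → Subgroup.center G → M) :
    ∑ z, ∑ y, ∑ c, ∑ d, (Q.toFun z c * Q.toFun y d) • X c d (z * y) =
      ∑ w, ∑ c, Q.toFun w c • X c c w := by
  calc _ = ∑ z, ∑ w, ∑ c, ∑ d, (Q.toFun z c * Q.toFun (z⁻¹ * w) d) • X c d w :=
        Finset.sum_congr rfl fun z _ =>
          Fintype.sum_equiv (Equiv.mulLeft z) _ _ fun y => by simp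
    _ = _ := by
        rw [Finset.sum_comm]
        refine Finset.sum_congr rfl fun w _ => ?_
        rw [Finset.sum_comm]
        refine Finset.sum_congr rfl fun c _ => ?_
        rw [Finset.sum_comm]
        simp only [← Finset.sum_smul, Q.mul_left]
        simp

/-- Central factors pass through every conjugation. `mul_right` forces equal shifts z = y, which
cancel and restore the original matching condition. -/
theorem centralMap_basisVec_mul (Q : CentralPairing k G) (g g' h h' : G) :
    centralMap Q (basisVec g g' * basisVec h h') =
      centralMap Q (basisVec g g') * centralMap Q (basisVec h h') := by
  have hterm (z c y d : Subgroup.center G) :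
      (basisVec ((z : G)⁻¹ * g) (c * g') * basisVec ((y : G)⁻¹ * h) (d * h') :
        DrinfeldDouble k G) = if (z : G)⁻¹ * g = (y : G)⁻¹ * (g' * h * g'⁻¹) then
        basisVec ((z : G)⁻¹ * g) (((c * d : Subgroup.center G) : G) * (g' * h')) else 0 := by
    have e1 : (c : G) * g' * ((y : G)⁻¹ * h) * (c * g')⁻¹ = (y : G)⁻¹ * (g' * h * g'⁻¹) := by
      have h1 := mul_coe_center y⁻¹ (c * g')
      have h3 := mul_coe_center c (g' * h * g'⁻¹)
      push_cast at h1
      calc _ = ((c : G) * g' * (y : G)⁻¹) * h * (g'⁻¹ * (c : G)⁻¹) := by group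
        _ = (y : G)⁻¹ * (((c : G) * (g' * h * g'⁻¹)) * (c : G)⁻¹) := by rw [h1]; group
        _ = _ := by rw [← h3]; group
    have e2 : (c : G) * g' * (d * h') = ((c * d : Subgroup.center G) : G) * (g' * h') := by
      rw [← mul_assoc, mul_assoc (c : G), mul_coe_center d g']
      push_cast
      group
    rw [basisVec_mul, e1, e2]
  symm
  calc _ = ∑ z : Subgroup.center G, ∑ y : Subgroup.center G, ∑ c : Subgroup.center G,
        ∑ d : Subgroup.center G, (Q.toFun z c * Q.toFun y d) •
          if (z : G)⁻¹ * g = (y : G)⁻¹ * (g' * h * g'⁻¹) then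
          (basisVec ((z : G)⁻¹ * g) (((c * d : Subgroup.center G) : G) * (g' * h')) :
            DrinfeldDouble k G) else 0 := by
        simp only [centralMap_basisVec, Finset.sum_mul_sum, smul_mul_smul_comm, hterm]
    _ = ∑ z : Subgroup.center G, ∑ y : Subgroup.center G, if z = y then ∑ e : Subgroup.center G,
        Q.toFun z e • if (z : G)⁻¹ * g = (y : G)⁻¹ * (g' * h * g'⁻¹) then
          (basisVec ((z : G)⁻¹ * g) ((e : G) * (g' * h')) : DrinfeldDouble k G) else 0 else 0 :=
        Finset.sum_congr rfl fun z _ => Finset.sum_congr rfl fun y _ =>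
          Q.sum_smul_mul_right (fun e => if (z : G)⁻¹ * g = (y : G)⁻¹ * (g' * h * g'⁻¹) then
          (basisVec ((z : G)⁻¹ * g) ((e : G) * (g' * h')) : DrinfeldDouble k G) else 0) z y
    _ = _ := by
        rw [basisVec_mul]
        simp only [Finset.sum_ite_eq, Finset.mem_univ, if_true, mul_right_inj]
        split_ifs with hg
        · rw [centralMap_basisVec]
        · simp

theorem sum_tmul_sum {ι κ M : Type*} [Fintype ι] [Fintype κ] [AddCommGroup M] [Module k M]
    (X : ι → M) (Y : κ → M) :
    (∑ i, X i) ⊗ₜ[k] (∑ j, Y j) = ∑ i, ∑ j, X i ⊗ₜ[k] Y j := by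
  rw [TensorProduct.sum_tmul]
  simp only [TensorProduct.tmul_sum]

theorem comul_centralMap_basisVec (Q : CentralPairing k G) (g h : G) :
    CoalgebraStruct.comul (R := k) (centralMap Q (basisVec g h)) =
      TensorProduct.map (centralMap Q) (centralMap Q)
        (CoalgebraStruct.comul (R := k) (basisVec g h)) := by
  symm
  let X (a : G) (c d w : Subgroup.center G) :
      TensorProduct k (DrinfeldDouble k G) (DrinfeldDouble k G) :=
    basisVec (a⁻¹ * ((w : G)⁻¹ * g)) (c * h) ⊗ₜ[k] basisVec a (d * h)
  calc _ = ∑ a : G, ∑ z : Subgroup.center G, ∑ y : Subgroup.center G, ∑ c : Subgroup.center G,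
        ∑ d : Subgroup.center G, (Q.toFun z c * Q.toFun y d) •
          ((basisVec ((z : G)⁻¹ * (a⁻¹ * g)) (c * h) : DrinfeldDouble k G) ⊗ₜ[k]
            (basisVec ((y : G)⁻¹ * a) (d * h) : DrinfeldDouble k G)) := by
        simp only [comul_basisVec, map_sum, TensorProduct.map_tmul, centralMap_basisVec,
          sum_tmul_sum, TensorProduct.smul_tmul_smul]
    _ = ∑ z : Subgroup.center G, ∑ y : Subgroup.center G, ∑ a : G, ∑ c : Subgroup.center G,
        ∑ d : Subgroup.center G, (Q.toFun z c * Q.toFun y d) • X a c d (z * y) := by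
        rw [Finset.sum_comm]
        refine Finset.sum_congr rfl fun z _ => ?_
        rw [Finset.sum_comm]
        refine Finset.sum_congr rfl fun y _ => ?_
        -- Absorbing y into `a` makes the term depend on z and y only through `z * y`, as
        -- `sum_smul_mul_left` requires.
        refine Fintype.sum_equiv (Equiv.mulLeft (y : G)⁻¹) _ _ fun a => ?_
        have e1 : (z : G)⁻¹ * (a⁻¹ * g) =
            ((y : G)⁻¹ * a)⁻¹ * (((z * y : Subgroup.center G) : G)⁻¹ * g) := by
          have h1 := mul_coe_center y a⁻¹
          have h2 := mul_coe_center z⁻¹ a⁻¹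
          push_cast at h2 ⊢
          calc _ = a⁻¹ * (z : G)⁻¹ * g := by rw [h2]; group
            _ = _ := by group
        simp only [Equiv.coe_mulLeft, X, e1]
    _ = ∑ a : G, ∑ w : Subgroup.center G, ∑ c : Subgroup.center G,
        Q.toFun w c • X a c c w := by
        simp only [← Q.sum_smul_mul_left]
        symm
        rw [Finset.sum_comm]
        refine Finset.sum_congr rfl fun z _ => ?_
        rw [Finset.sum_comm]
    _ = _ := by
        rw [Finset.sum_comm]
        simp only [centralMap_basisVec, map_sum, map_smul, comul_basisVec, Finset.smul_sum]
        refine Finset.sum_congr rfl fun z _ => ?_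
        rw [Finset.sum_comm]

/-- The automorphism of `D(G)` with component `k^G → k^Z → kZ → kG` given by `Q`. -/
noncomputable def centralPairingAut (Q : CentralPairing k G) :
    DrinfeldDouble k G ≃ₐc[k] DrinfeldDouble k G :=
  autOfBasis (centralMap Q) (centralMap Q.inv)
    (centralMap_inv Q Q.inv fun _ _ => rfl)
    (centralMap_inv Q.inv Q fun z c => by simp [CentralPairing.inv])
    (centralMap_basisVec_mul Q)
    (fun g h => by
      simp only [centralMap_basisVec, map_sum, map_smul, counit_basisVec, ← Finset.sum_smul,
        Q.sum_right]
      rw [Finset.sum_eq_single 1 (by intro z _ hz; simp [hz]) (by simp)]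
      simp)
    (comul_centralMap_basisVec Q)

theorem centralPairingAut_basisVec (Q : CentralPairing k G) (g h : G) :
    centralPairingAut Q (basisVec g h) = ∑ z : Subgroup.center G, ∑ c : Subgroup.center G,
      Q.toFun z c • basisVec ((z : G)⁻¹ * g) ((c : G) * h) :=
  centralMap_basisVec Q g h

/-- `hχ` says that Q, as a map k^Z → kZ, sends the restriction of χ to the group element c. -/
theorem centralPairingAut_tmul (Q : CentralPairing k G) (χ : G →* kˣ) (c : Subgroup.center G)
    (hχ : ∀ d, ∑ z, Q.toFun z d * χ z = if d = c then 1 else 0) (h : G) :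
    centralPairingAut Q (tmul (fun x => (χ x : k)) h) =
      tmul (fun x => (χ x : k)) (c * h) := by
  refine ext' fun x y => ?_
  change (∑ z : Subgroup.center G, ∑ d : Subgroup.center G, Q.toFun z d *
    (tmul (fun x => (χ x : k)) h : DrinfeldDouble k G) ((z : G) * x, (d : G)⁻¹ * y)) = _
  simp only [tmul]
  rw [Finset.sum_comm]
  have (d : Subgroup.center G) : (∑ z : Subgroup.center G, Q.toFun z d *
      if (d : G)⁻¹ * y = h then (χ ((z : G) * x) : k) else 0) =
      if d = c then (if (d : G)⁻¹ * y = h then (χ x : k) else 0) else 0 := by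
    by_cases h1 : (d : G)⁻¹ * y = h
    · simp only [h1, if_true, map_mul, Units.val_mul, ← mul_assoc, ← Finset.sum_mul, hχ, ite_mul,
        one_mul, zero_mul]
    · simp [h1]
  simp only [this]
  simp [inv_mul_eq_iff_eq_mul]

theorem centralPairingAut_mem_Lambda (Q : CentralPairing k G) :
    centralPairingAut Q ∈ Lambda k G := by
  rw [mem_Lambda_iff]
  refine ⟨fun y => dualComp_unique _ (s := fun y => y) (fun g y => ?_) y, fun h => ?_⟩
  · rw [centralPairingAut_basisVec]
    have h1 : projDualLin (∑ z : Subgroup.center G, ∑ c : Subgroup.center G,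
        Q.toFun z c • (basisVec ((z : G)⁻¹ * g) ((c : G) * 1) : DrinfeldDouble k G)) =
        Pi.single g 1 := by
      have h2 (a b : G) : projDualLin (basisVec a b : DrinfeldDouble k G) = Pi.single a 1 :=
        projDual_basisVec a b
      simp only [map_sum, map_smul, h2, ← Finset.sum_smul, Q.sum_right]
      simp
    refine (congrFun h1 y).trans ?_
    simp [Pi.single_apply]
  · have := centralPairingAut_tmul Q 1 1 (by simpa using Q.sum_left) h
    simpa using! this

/-- Conjugating by a bicharacter `r` exhibits the value of the pairing at `r(h)⁻¹`. -/
theorem exists_center_map_eq_one_of_normal (hN : (Lambda k G).Normal) (Q : CentralPairing k G)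
    (r : Bicharacter G k) (h : G) (c : Subgroup.center G)
    (hc : ∀ d, ∑ z, Q.toFun z d * (r h)⁻¹ z = if d = c then 1 else 0) : c = 1 := by
  have h1 := ((mem_Lambda_iff _).1 (hN.conj_mem _ (centralPairingAut_mem_Lambda Q)
    (bicharacterHom r))).2 h
  have hb (s : Bicharacter G k) (χ : G →* kˣ) (l : G) : bicharacterHom s
      (tmul (fun x => (χ x : k)) l) = tmul (fun x => ((s l * χ) x : k)) l := by
    refine ext' fun a b => ?_
    change (s b a : k) * (tmul (fun x => (χ x : k)) l : DrinfeldDouble k G) (a, b) = _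
    simp only [tmul]
    split_ifs with hl
    · subst hl; simp
    · simp
  have h2 : (tmul 1 h : DrinfeldDouble k G) = tmul (fun x => ((1 : G →* kˣ) x : k)) h := rfl
  rw [← map_inv, BialgEquiv.aut_mul_apply, BialgEquiv.aut_mul_apply, h2, hb,
    centralPairingAut_tmul Q _ c (by simpa using hc), hb] at h1
  have h3 := (tmul_char_inj h1).2
  exact Subtype.ext (mul_eq_right.1 h3)

end CentralPairing

end DrinfeldDouble

namespace DrinfeldDouble

/-! ### Fourier pairing on the centre, and necessity of the stem condition. -/

section Nondegenerate

variable {k : Type*} [Field k] {G : Type*} [Group G] [Fintype G] [DecidableEq G]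

theorem sum_char_units {A : Type*} [Group A] [Fintype A] (χ : A →* kˣ) [Decidable (χ = 1)] :
    ∑ a, (χ a : k) = if χ = 1 then (Fintype.card A : k) else 0 := by
  classical
  have h := sum_hom_units ((Units.coeHom k).comp χ)
  have h1 : (Units.coeHom k).comp χ = 1 ↔ χ = 1 := by
    refine ⟨fun h => MonoidHom.ext fun a => Units.ext (DFunLike.congr_fun h a), ?_⟩
    rintro rfl
    rfl
  simp only [h1] at h
  push_cast at h
  exact h

/-- The pairing given by an isomorphism of the centre with its character group. -/
noncomputable def CentralPairing.ofEquiv [CharZero k]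
    (β : Subgroup.center G ≃* (Subgroup.center G →* kˣ))
    (hβ : ∀ z : Subgroup.center G, (∀ χ : Subgroup.center G →* kˣ, χ z = 1) → z = 1) :
    CentralPairing k G :=
  have hN : (Fintype.card (Subgroup.center G) : k) ≠ 0 := Nat.cast_ne_zero.2 Fintype.card_ne_zero
  have hl (c : Subgroup.center G) :
      ∑ z, (β c z : k) = if c = 1 then (Fintype.card (Subgroup.center G) : k) else 0 := by
    classical
    rw [sum_char_units]
    simp
  have hr (z : Subgroup.center G) :
      ∑ c, (β c z : k) = if z = 1 then (Fintype.card (Subgroup.center G) : k) else 0 := by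
    classical
    let f : Subgroup.center G →* kˣ := (MonoidHom.eval z).comp β.toMonoidHom
    refine (sum_char_units f).trans (if_congr ?_ rfl rfl)
    refine ⟨fun h => hβ z fun χ => ?_, ?_⟩
    · obtain ⟨c, rfl⟩ := β.surjective χ
      exact DFunLike.congr_fun h c
    · rintro rfl
      exact MonoidHom.ext fun c => map_one (β c)
  -- The inverse Fourier matrix: it sends the character `β c` to `c`. The four axioms are the
  -- orthogonality relations `hl` and `hr`.
  { toFun := fun z c => (Fintype.card (Subgroup.center G) : k)⁻¹ * (β c z⁻¹ : k)
    mul_right := fun z z' e => by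
      have h (c : Subgroup.center G) : (Fintype.card (Subgroup.center G) : k)⁻¹ * (β c z⁻¹ : k) *
          ((Fintype.card (Subgroup.center G) : k)⁻¹ * (β (c⁻¹ * e) z'⁻¹ : k)) =
          (Fintype.card (Subgroup.center G) : k)⁻¹ * (Fintype.card (Subgroup.center G) : k)⁻¹ *
            β e z'⁻¹ * β c (z' * z⁻¹) := by
        simp only [map_mul, map_inv, MonoidHom.mul_apply, MonoidHom.inv_apply, inv_inv,
          Units.val_mul, mul_inv_rev]
        ring
      simp only [h, ← Finset.mul_sum, hr, mul_inv_eq_one, eq_comm (a := z')]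
      split_ifs with hz
      · subst hz; field_simp
      · simp
    mul_left := fun c c' w => by
      have h (z : Subgroup.center G) : (Fintype.card (Subgroup.center G) : k)⁻¹ * (β c z⁻¹ : k) *
          ((Fintype.card (Subgroup.center G) : k)⁻¹ * (β c' (z⁻¹ * w)⁻¹ : k)) =
          (Fintype.card (Subgroup.center G) : k)⁻¹ * (Fintype.card (Subgroup.center G) : k)⁻¹ *
            β c' w⁻¹ * β (c' * c⁻¹) z := by
        simp only [map_mul, map_inv, MonoidHom.mul_apply, MonoidHom.inv_apply, inv_inv,
          Units.val_mul, mul_inv_rev]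
        ring
      simp only [h, ← Finset.mul_sum, hl, mul_inv_eq_one, eq_comm (a := c')]
      split_ifs with hz
      · subst hz; field_simp
      · simp
    sum_left := fun c => by
      have h : ∑ z, (β c z⁻¹ : k) = ∑ z, (β c z : k) :=
        Fintype.sum_equiv (Equiv.inv _) _ _ fun z => rfl
      rw [← Finset.mul_sum, h, hl]
      split_ifs <;> simp [hN]
    sum_right := fun z => by
      simp only [← Finset.mul_sum, hr, inv_eq_one]
      split_ifs <;> simp [hN] }

theorem CentralPairing.sum_ofEquiv_mul [CharZero k]
    (β : Subgroup.center G ≃* (Subgroup.center G →* kˣ))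
    (hβ : ∀ z : Subgroup.center G, (∀ χ : Subgroup.center G →* kˣ, χ z = 1) → z = 1)
    (c d : Subgroup.center G) :
    ∑ z, (CentralPairing.ofEquiv β hβ).toFun z d * (β c z : k) = if d = c then 1 else 0 := by
  classical
  have hN : (Fintype.card (Subgroup.center G) : k) ≠ 0 := Nat.cast_ne_zero.2 Fintype.card_ne_zero
  have h (z : Subgroup.center G) : (Fintype.card (Subgroup.center G) : k)⁻¹ * (β d z⁻¹ : k) *
      (β c z : k) = (Fintype.card (Subgroup.center G) : k)⁻¹ * (β (d⁻¹ * c) z : k) := by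
    simp only [map_mul, map_inv, MonoidHom.mul_apply, MonoidHom.inv_apply, Units.val_mul]
    ring
  change ∑ z, (Fintype.card (Subgroup.center G) : k)⁻¹ * (β d z⁻¹ : k) * (β c z : k) = _
  simp only [h, ← Finset.mul_sum, sum_char_units]
  have : β (d⁻¹ * c) = 1 ↔ d = c := by simp [inv_mul_eq_one]
  simp only [this]
  split_ifs <;> simp [hN]

open scoped IsMulCommutative in
theorem exists_center_equiv_char [IsAlgClosed k] [CharZero k] :
    ∃ _ : Subgroup.center G ≃* (Subgroup.center G →* kˣ),
      ∀ z : Subgroup.center G, (∀ χ : Subgroup.center G →* kˣ, χ z = 1) → z = 1 := by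
  have : NeZero ((Monoid.exponent (Subgroup.center G) : ℕ) : k) :=
    ⟨Nat.cast_ne_zero.2 Monoid.exponent_ne_zero_of_finite⟩
  refine ⟨(CommGroup.monoidHom_mulEquiv_of_hasEnoughRootsOfUnity
    (Subgroup.center G) k).some.symm, fun z hz => ?_⟩
  by_contra hne
  obtain ⟨χ, hχ⟩ := CommGroup.exists_apply_ne_one_of_hasEnoughRootsOfUnity
    (Subgroup.center G) k hne
  exact hχ (hz χ)

/-- A central z outside G' is detected by a character χ of the abelianization, and this χ produces
an element of Λ(G) with a conjugate outside Λ(G). -/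
theorem isStemGroup_of_Lambda_normal [IsAlgClosed k] [CharZero k]
    (hN : (Lambda k G).Normal) : IsStemGroup G := by
  intro z hz
  by_contra hz'
  have : NeZero ((Monoid.exponent (Abelianization G) : ℕ) : k) :=
    ⟨Nat.cast_ne_zero.2 Monoid.exponent_ne_zero_of_finite⟩
  have hz1 : Abelianization.of z ≠ 1 := fun h => hz' ((QuotientGroup.eq_one_iff z).1 h)
  obtain ⟨χ, hχ⟩ := CommGroup.exists_apply_ne_one_of_hasEnoughRootsOfUnity
    (Abelianization G) k hz1
  let e := (CommGroup.monoidHom_mulEquiv_of_hasEnoughRootsOfUnity (Abelianization G) k).some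
  obtain ⟨β, hβ⟩ := exists_center_equiv_char (k := k) (G := G)
  -- Inflated from an isomorphism of the abelianization with its dual, so that every linear
  -- character of G occurs as some r(h).
  let r : Bicharacter G k :=
    { toFun := fun h => (e.symm (Abelianization.of h)).comp Abelianization.of
      map_one' := by ext; simp
      map_mul' := fun a b => by ext; simp }
  obtain ⟨h, hh⟩ := QuotientGroup.mk_surjective (e χ⁻¹)
  have hr : r h = (χ.comp Abelianization.of)⁻¹ := by
    change (e.symm (Abelianization.of h)).comp Abelianization.of = _
    rw [show Abelianization.of h = e χ⁻¹ from hh, e.symm_apply_apply]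
    rfl
  -- Normality will force c = 1, making χ trivial on the centre, against χ(z) ≠ 1.
  obtain ⟨c, hc⟩ := β.surjective ((χ.comp Abelianization.of).comp (Subgroup.center G).subtype)
  have hc1 := exists_center_map_eq_one_of_normal hN (CentralPairing.ofEquiv β hβ) r h c
    fun d => by
      refine (Finset.sum_congr rfl fun z _ => ?_).trans (CentralPairing.sum_ofEquiv_mul β hβ c d)
      rw [hr, hc]
      simp
  rw [hc1, map_one] at hc
  exact hχ (DFunLike.congr_fun hc ⟨z, hz⟩).symm

end Nondegenerate

/-! ### Normality of Λ(G) versus the semidirect decomposition. -/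

section Semidirect

variable {k : Type*} [Field k] {G : Type*} [Group G] [Fintype G] [DecidableEq G]

theorem isStemGroup_of_semidirect [IsAlgClosed k] [CharZero k]
    (φ : BChSplit G k →* MulAut (Lambda k G))
    (e : (Lambda k G) ⋊[φ] (BChSplit G k) ≃* (DrinfeldDouble k G ≃ₐc[k] DrinfeldDouble k G))
    (h1 : ∀ p : Lambda k G, e (SemidirectProduct.inl p) = p) : IsStemGroup G := by
  refine isStemGroup_of_Lambda_normal (k := k) ⟨fun l hl ψ => ?_⟩
  obtain ⟨y, rfl⟩ := e.surjective ψ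
  have h2 : y * SemidirectProduct.inl ⟨l, hl⟩ * y⁻¹ ∈
      (SemidirectProduct.inl : _ →* (Lambda k G) ⋊[φ] (BChSplit G k)).range := by
    -- The left factor is the kernel of the projection to the right factor, hence normal; `e`
    -- carries this to Λ(G).
    rw [SemidirectProduct.range_inl_eq_ker_rightHom, MonoidHom.mem_ker]
    simp
  obtain ⟨p, hp⟩ := h2
  have h3 := congrArg e hp
  rw [map_mul, map_mul, map_inv, h1, h1] at h3
  rw [← h3]
  exact p.2

theorem exists_semidirect_of_isStemGroup (hG : IsStemGroup G) :
    ∃ (φ : BChSplit G k →* MulAut (Lambda k G))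
      (e : (Lambda k G) ⋊[φ] (BChSplit G k) ≃* (DrinfeldDouble k G ≃ₐc[k] DrinfeldDouble k G)),
      (∀ p : Lambda k G, e (SemidirectProduct.inl p) = p) ∧
      (∀ x : BChSplit G k, e (SemidirectProduct.inr x) = bchSplitHom x) := by
  have := Lambda_normal (k := k) hG
  let φ : BChSplit G k →* MulAut (Lambda k G) := MulAut.conjNormal.comp bchSplitHom
  have hφ (x : BChSplit G k) : (Lambda k G).subtype.comp (φ x).toMonoidHom =
      (MulAut.conj (bchSplitHom x)).toMonoidHom.comp (Lambda k G).subtype := by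
    ext1 p
    exact MulAut.conjNormal_apply _ _
  let f : (Lambda k G) ⋊[φ] (BChSplit G k) →* (DrinfeldDouble k G ≃ₐc[k] DrinfeldDouble k G) :=
    SemidirectProduct.lift (Lambda k G).subtype bchSplitHom hφ
  have hf : Function.Bijective f := by
    constructor
    · refine (injective_iff_map_eq_one f).2 fun y hy => ?_
      have h1 : (y.left : DrinfeldDouble k G ≃ₐc[k] DrinfeldDouble k G) *
        bchSplitHom y.right = 1 := hy
      -- The image of `y.right` is inverse to an element of Λ(G), and the embedded complement meets
      -- Λ(G) trivially.
      have h2 : y.right = 1 := by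
        rw [← bchSplitHom_mem_Lambda_iff, ← inv_eq_of_mul_eq_one_right h1]
        exact inv_mem y.left.2
      rw [h2, map_one, mul_one] at h1
      exact SemidirectProduct.ext (Subtype.ext h1) h2
    · intro ψ
      obtain ⟨x, hx⟩ := exists_inv_bchSplitHom_mul_mem_Lambda ψ hG
      -- `hx` puts the Λ(G)-factor on the right of the complement; conjugation moves it to the left.
      refine ⟨⟨⟨_, this.conj_mem _ hx (bchSplitHom x)⟩, x⟩, ?_⟩
      change bchSplitHom x * ((bchSplitHom x)⁻¹ * ψ) * (bchSplitHom x)⁻¹ * bchSplitHom x = ψ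
      group
  exact ⟨φ, MulEquiv.ofBijective f hf, fun p => SemidirectProduct.lift_inl _ _ hφ p,
    fun x => SemidirectProduct.lift_inr _ _ hφ x⟩

end Semidirect

end DrinfeldDouble

theorem mainTheorem9 {k : Type*} [Field k] [IsAlgClosed k] [CharZero k]
    {G : Type*} [Group G] [Fintype G] [DecidableEq G] :
    ((DrinfeldDouble.Lambda k G).Normal ↔ IsStemGroup G) ∧
    ((∃ (φ : BChSplit G k →* MulAut (DrinfeldDouble.Lambda k G))
        (e : (DrinfeldDouble.Lambda k G) ⋊[φ] (BChSplit G k) ≃*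
          (DrinfeldDouble k G ≃ₐc[k] DrinfeldDouble k G)),
        (∀ p : DrinfeldDouble.Lambda k G, e (SemidirectProduct.inl p) = p) ∧
        (∀ x : BChSplit G k, e (SemidirectProduct.inr x) = DrinfeldDouble.bchSplitHom x)) ↔
      IsStemGroup G) := by
  exact ⟨⟨DrinfeldDouble.isStemGroup_of_Lambda_normal, DrinfeldDouble.Lambda_normal⟩,
    fun ⟨φ, e, h, _⟩ => DrinfeldDouble.isStemGroup_of_semidirect φ e h,
    DrinfeldDouble.exists_semidirect_of_isStemGroup⟩
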